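/- Let $K$ be an algebraically closed field of characteristic $0$. For a projective variety $Y\subset\mathbb P^m$ over $K$ and an integer $s\ge 1$, let $\sigma_s(Y)$ be the Zariski closure of the union of the linear spans $\langle P_1,\dots,P_s\rangle$ over all $P_1,\dots,P_s\in Y$ (not necessarily distinct). We say that $\sigma_s(Y)$ is defective (equivalently, that $Y$ is $s$-defective) if $$\dim\sigma_s(Y)\neq\min\{\,s(\dim Y+1)-1,\ m\,\}.$$ (1) Let $X\subset\mathbb P^r$ be an irreducible non-degenerate projective variety of dimension $n$, and let $Seg(\mathbb P^k\times X)\subset\mathbb P^{rk+r+k}$ be the image of $\mathbb P^k\times X$ under the Segre embedding. If $k=r-n$, then $\sigma_s(Seg(\mathbb P^k\times X))$ is not defective, for every $s\ge 1$. (2) Let $n\ge 0$ and let $Y$ be the Segre–Veronese embedding of $\mathbb P^{\binom{n+1}{2}}\times\mathbb P^n$ by bidegree $(1,2)$. Then $\sigma_s(Y)$ is not defective, for every $s\ge 1$. (3) Let $t\ge 0$, $n_1,\dots,n_t\ge 0$, $d_1,\dots,d_t\ge 1$, and let $Y$ be the Segre–Veronese embedding of $\mathbb P^k\times\mathbb P^{n_1}\times\cdots\times\mathbb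 P^{n_t}$ by multidegree $(1,d_1,\dots,d_t)$. If $k=\prod_{i=1}^t\binom{n_i+d_i}{d_i}-\sum_{i=1}^t n_i-1$, then $\sigma_s(Y)$ is not defective, for every $s\ge 1$. Here the Segre–Veronese embedding by multidegree $(e_0,\dots,e_t)$ is the map whose homogeneous coordinates are all products of one monomial of degree $e_i$ in the coordinates of each factor. -/

import Mathlib

open scoped LinearAlgebra.Projectivization

noncomputable section

namespace SecantVar

/-- The common zero locus, in the projective space with homogeneous coordinates indexed by `ι`, of
a set of polynomials. It is used for sets of homogeneous polynomials only, where the choice of the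
representative `p.rep` is irrelevant. -/
def zeroLocus {K : Type*} [Field K] {ι : Type*} (S : Set (MvPolynomial ι K)) :
    Set (ℙ K (ι → K)) :=
  {p | ∀ f ∈ S, MvPolynomial.eval p.rep f = 0}

/-- The Zariski topology: the closed sets are the zero loci of sets of homogeneous polynomials. -/
instance zariskiTopology {K : Type*} [Field K] {ι : Type*} :
    TopologicalSpace (ℙ K (ι → K)) :=
  TopologicalSpace.ofClosed
    {Z | ∃ S : Set (MvPolynomial ι K), (∀ f ∈ S, ∃ d : ℕ, f.IsHomogeneous d) ∧ Z = zeroLocus S}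
    (by
      refine ⟨{1}, ?_, ?_⟩
      · rintro f rfl
        exact ⟨0, MvPolynomial.isHomogeneous_one ι K⟩
      · ext p
        simp [zeroLocus])
    (by
      intro A hA
      refine ⟨{f | (∃ d : ℕ, f.IsHomogeneous d) ∧
        ∃ Z ∈ A, ∀ p ∈ Z, MvPolynomial.eval p.rep f = 0}, fun f hf => hf.1, ?_⟩
      ext p
      constructor
      · rintro hp f ⟨-, Z, hZ, hf⟩
        exact hf p (hp Z hZ)
      · intro hp Z hZ
        obtain ⟨S, hS, rfl⟩ := hA hZ
        intro f hf
        exact hp f ⟨hS f hf, _, hZ, fun q hq => hq f hf⟩)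
    (by
      rintro _ ⟨S, hS, rfl⟩ _ ⟨T, hT, rfl⟩
      refine ⟨{h | ∃ f ∈ S, ∃ g ∈ T, h = f * g}, ?_, ?_⟩
      · rintro _ ⟨f, hf, g, hg, rfl⟩
        obtain ⟨a, ha⟩ := hS f hf
        obtain ⟨b, hb⟩ := hT g hg
        exact ⟨a + b, ha.mul hb⟩
      · ext p
        constructor
        · rintro (hp | hp)
          · rintro _ ⟨f, hf, g, hg, rfl⟩
            rw [map_mul, hp f hf, zero_mul]
          · rintro _ ⟨f, hf, g, hg, rfl⟩
            rw [map_mul, hp g hg, mul_zero]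
        · intro hp
          by_contra hcon
          rw [Set.mem_union, not_or] at hcon
          obtain ⟨h1, h2⟩ := hcon
          simp only [zeroLocus, Set.mem_ofPred_eq, not_forall] at h1 h2
          obtain ⟨f, hf, hf0⟩ := h1
          obtain ⟨g, hg, hg0⟩ := h2
          have h := hp (f * g) ⟨f, hf, g, hg, rfl⟩
          rw [map_mul] at h
          exact (mul_ne_zero hf0 hg0) h)

/-- An irreducible non-degenerate projective variety: a Zariski closed irreducible (in particular
non-empty) set of points of projective space whose linear span is the whole space. -/
structure IsNondegenerateVariety {K : Type*} [Field K] {ι : Type*} (Y : Set (ℙ K (ι → K))) :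
    Prop where
  isClosed : IsClosed Y
  isIrreducible : IsIrreducible Y
  span_eq_top : Projectivization.Subspace.span Y = ⊤

/-- The dimension of a set of points of projective space: the Krull dimension of its Zariski
topology. -/
def dim {K : Type*} [Field K] {ι : Type*} (Y : Set (ℙ K (ι → K))) : WithBot ℕ∞ :=
  topologicalKrullDim Y

/-- The `s`-th secant variety: the Zariski closure of the union of the linear spans
`⟨P₁, …, Pₛ⟩` over all points `P₁, …, Pₛ` of `Y`. -/
def secantVariety {K : Type*} [Field K] {ι : Type*} (s : ℕ) (Y : Set (ℙ K (ι → K))) :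
    Set (ℙ K (ι → K)) :=
  closure (⋃ (P : Fin s → ℙ K (ι → K)) (_ : ∀ i, P i ∈ Y),
    (Projectivization.Subspace.span (Set.range P) : Set (ℙ K (ι → K))))

/-- `Y` in `ℙ^m`, where `m + 1 = Fintype.card ι`, is `s`-defective when its `s`-th secant variety
does not have the expected dimension `min {s (dim Y + 1) - 1, m}`. Both sides are raised by `1`
here, so that no subtraction occurs. -/
def IsDefective {K : Type*} [Field K] {ι : Type*} [Fintype ι] (s : ℕ) (Y : Set (ℙ K (ι → K))) :
    Prop :=
  dim (secantVariety s Y) + 1 ≠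
    min ((s : WithBot ℕ∞) * (dim Y + 1)) (Fintype.card ι : WithBot ℕ∞)

theorem segre_ne_zero {K : Type*} [Field K] {α β : Type*}
    {u : α → K} {v : β → K} (hu : u ≠ 0) (hv : v ≠ 0) :
    (fun ij : α × β => u ij.1 * v ij.2) ≠ 0 := by
  obtain ⟨i, hi⟩ := Function.ne_iff.mp hu
  obtain ⟨j, hj⟩ := Function.ne_iff.mp hv
  exact Function.ne_iff.mpr ⟨(i, j), mul_ne_zero hi hj⟩

/-- The Segre map `([λ], [x]) ↦ [λ_i x_j]`. -/
def segreMap {K : Type*} [Field K] {α β : Type*} (q : ℙ K (α → K) × ℙ K (β → K)) :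
    ℙ K (α × β → K) :=
  Projectivization.mk K (fun ij : α × β => q.1.rep ij.1 * q.2.rep ij.2)
    (segre_ne_zero q.1.rep_nonzero q.2.rep_nonzero)

/-- The Segre product `Seg(ℙ^k × X)`. -/
def segreProduct {K : Type*} [Field K] {β : Type*} (k : ℕ) (X : Set (ℙ K (β → K))) :
    Set (ℙ K (Fin (k + 1) × β → K)) :=
  segreMap '' (Set.univ ×ˢ X)

theorem segreVeronese_ne_zero {K : Type*} [Field K] {σ : Type*} [Fintype σ] (n d : σ → ℕ)
    {v : ∀ i, Fin (n i + 1) → K} (hv : ∀ i, v i ≠ 0) :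
    (fun m : (∀ i, Sym (Fin (n i + 1)) (d i)) =>
      ∏ i, ((m i : Multiset (Fin (n i + 1))).map (v i)).prod) ≠ 0 := by
  choose j hj using fun i => Function.ne_iff.mp (hv i)
  refine Function.ne_iff.mpr ⟨fun i => Sym.replicate (d i) (j i), ?_⟩
  simp only [Pi.zero_apply]
  refine Finset.prod_ne_zero_iff.mpr fun i _ => ?_
  rw [Sym.coe_replicate, Multiset.map_replicate, Multiset.prod_replicate]
  exact pow_ne_zero _ (hj i)

/-- The Segre-Veronese map of multidegree `d` on `∏ i, ℙ^(n i)`. Its coordinates are all the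
products over `i` of a monomial of degree `d i` in the coordinates of the `i`-th factor; such a
monomial is given by the multiset of the `d i` indices of its variables. -/
def segreVeroneseMap {K : Type*} [Field K] {σ : Type*} [Fintype σ] (n d : σ → ℕ)
    (p : ∀ i, ℙ K (Fin (n i + 1) → K)) :
    ℙ K ((∀ i, Sym (Fin (n i + 1)) (d i)) → K) :=
  Projectivization.mk K
    (fun m => ∏ i, ((m i : Multiset (Fin (n i + 1))).map (p i).rep).prod)
    (segreVeronese_ne_zero n d fun i => (p i).rep_nonzero)

/-- The Segre-Veronese variety of `∏ i, ℙ^(n i)` embedded by multidegree `d`. -/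
def segreVeronese (K : Type*) [Field K] {σ : Type*} [Fintype σ] (n d : σ → ℕ) :
    Set (ℙ K ((∀ i, Sym (Fin (n i + 1)) (d i)) → K)) :=
  Set.range (segreVeroneseMap (K := K) n d)

end SecantVar

end

/-! Write `C ⊆ K^N` for the affine cone of the second factor and `Y` for the product variety. The
cone of `Y` consists of the tensors `u ⊗ x` with `u ∈ K^(k+1)` and `x ∈ C`, and the codimension
hypothesis says `dim C + k = N`. Scaling `u` against `x` bounds the dimension of this cone by `k +
dim C = N`. Hence `k + 1` summands have at most `(k+1)N` parameters, exactly the dimension of the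
ambient space. If `σ_(k+1)(Y)` fills that space, no dimension is lost at any stage. Each further
summand adds at most `N`, so `σ_s(Y)` has affine dimension `sN` for `s ≤ k+1`, and it stays full
afterwards (`not_isDefective_of_tensor`).

Filling is a Terracini argument (`eq_zero_of_forall_tensorSum`). Let `F` vanish at all sums `∑ u_i ⊗
x_i` with `k+1` terms. Moving `u_l` shows that the gradient of `F` kills `e_a ⊗ x_l` for all `a` and
`l`. Moving `x_i` along `C` shows that it kills `u_i ⊗ τ` for every `τ` tangent to `C` at `x_i`. So
the gradient contracted with `u_i` is a covector on `K^N` killing the tangent space at `x_i` and the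
`k` other points. Since `C` spans, these `dim C + k = N` vectors are independent for general points,
and the covector is zero. General `u_i` form a basis, so the whole gradient is zero at a general
sum, hence at every sum. The polynomials vanishing on the sums are thus stable under partial
derivatives, and in characteristic zero Taylor expansion at the origin gives `F = 0`
(`eq_zero_of_pderiv_stable`).

The remaining work is a bridge between definitions: topological Krull dimension is compared with the
transcendence degree of the coordinate ring of the cone (`dim_add_one`), and secant varieties with
sums of points of the cone (`cone_iUnion_span`). Segre–Veronese varieties with first degree `1` have
cones of the same tensor form, so they fall under the same criterion. -/

noncomputable section

namespace SecantVar

open MvPolynomial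
open scoped TensorProduct

/-! ### Krull dimension and transcendence degree -/

section Dimension

/-- Incomparability keeps contracted chains strict; lying over followed by going up lifts chains of
the base. -/
theorem ringKrullDim_eq_of_isIntegral {R S : Type*} [CommRing R] [CommRing S] [Algebra R S]
    [Algebra.IsIntegral R S] [IsDomain S] (hinj : Function.Injective (algebraMap R S)) :
    ringKrullDim S = ringKrullDim R := by
  apply le_antisymm
  · refine Order.krullDim_le_of_strictMono (PrimeSpectrum.comap (algebraMap R S)) ?_
    intro p q hpq
    exact Ideal.IsIntegral.comap_lt_comap (R := R) (I := p.asIdeal) (J := q.asIdeal) hpq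
  · refine iSup_le fun l => ?_
    have : (⊥ : Ideal S).IsPrime := Ideal.isPrime_bot
    obtain ⟨Q, -, hQ, hQl⟩ := Ideal.exists_ideal_over_prime_of_isIntegral_of_isPrime (S := S)
      l.head.asIdeal ⊥ (by
        intro x hx
        rw [Ideal.mem_comap, Ideal.mem_bot] at hx
        rw [(injective_iff_map_eq_zero _).mp hinj x hx]
        exact zero_mem _)
    have : Q.LiesOver l.head.asIdeal := ⟨hQl.symm⟩
    obtain ⟨L, hlen, -, -⟩ := Ideal.exists_ltSeries_of_hasGoingUp l Q
    rw [← hlen]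
    exact Order.LTSeries.length_le_krullDim L

theorem isAlgebraic_adjoin_range_of_isIntegral {K B : Type*} [Field K] [CommRing B] [IsDomain B]
    [Algebra K B] {σ : Type*} (h : MvPolynomial σ K →ₐ[K] B)
    (hint : h.toRingHom.IsIntegral) :
    Algebra.IsAlgebraic (Algebra.adjoin K (Set.range fun i => h (X i))) B := by
  have hr : Algebra.adjoin K (Set.range fun i => h (X i)) = h.range := by
    rw [Algebra.adjoin_range_eq_range_aeval]
    congr 1
    ext i
    simp
  rw [hr]
  refine ⟨fun b => IsIntegral.isAlgebraic ?_⟩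
  let _ := h.toRingHom.toAlgebra
  exact IsIntegral.map_of_comp_eq (R := MvPolynomial σ K) (S := B) h.rangeRestrict.toRingHom
    (RingHom.id B) rfl (a := b) (hint b)

theorem trdeg_le_of_isIntegral {K B : Type*} [Field K] [CommRing B] [IsDomain B] [Algebra K B]
    {σ : Type*} [Finite σ] (h : MvPolynomial σ K →ₐ[K] B) (hint : h.toRingHom.IsIntegral) :
    (Algebra.trdeg K B).toNat ≤ Nat.card σ := by
  have := isAlgebraic_adjoin_range_of_isIntegral h hint
  have h1 := Algebra.IsAlgebraic.trdeg_le_cardinalMk K (Set.range (fun i => h (X i)))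
  have h2 := Cardinal.toNat_le_toNat h1 (Cardinal.mk_lt_aleph0)
  refine h2.trans ?_
  exact Finite.card_range_le _

/-- Noether normalization. The number of variables is the transcendence degree because their images
are independent and everything is algebraic over them. -/
theorem exists_isIntegral_mvPolynomial (K A : Type*) [Field K] [CommRing A] [IsDomain A] [Algebra K
    A]
    [Algebra.FiniteType K A] :
    ∃ g : MvPolynomial (Fin (Algebra.trdeg K A).toNat) K →ₐ[K] A,
      Function.Injective g ∧ g.toRingHom.IsIntegral := by
  obtain ⟨s, g, hg, hint⟩ := exists_integral_inj_algHom_of_fg K A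
  have := isAlgebraic_adjoin_range_of_isIntegral g hint
  have hind : AlgebraicIndependent K (fun i => g (X i)) := by
    have : (aeval fun i => g (X i)) = g := by ext i; simp
    rw [AlgebraicIndependent, this]
    exact hg
  have hT : IsTranscendenceBasis K (fun i => g (X i)) :=
      hind.isTranscendenceBasis_iff_isAlgebraic.mpr this
  have h2 := hT.lift_cardinalMk_eq_trdeg
  have h3 : (Algebra.trdeg K A).toNat = s := by
    have := congrArg Cardinal.toNat h2
    simpa using this.symm
  rw [h3]
  exact ⟨g, hg, hint⟩

theorem ringKrullDim_eq_trdeg (K A : Type*) [Field K] [CommRing A] [IsDomain A] [Algebra K A]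
    [Algebra.FiniteType K A] : ringKrullDim A = ((Algebra.trdeg K A).toNat : ℕ) := by
  obtain ⟨g, hg, hint⟩ := exists_isIntegral_mvPolynomial K A
  let := g.toRingHom.toAlgebra
  have : Algebra.IsIntegral (MvPolynomial (Fin (Algebra.trdeg K A).toNat) K) A := ⟨hint⟩
  rw [ringKrullDim_eq_of_isIntegral (R := MvPolynomial (Fin (Algebra.trdeg K A).toNat) K) hg,
    MvPolynomial.ringKrullDim_of_isNoetherianRing, ringKrullDim_eq_zero_of_field]
  simp

end Dimension

/-! ### Irreducible sets in affine space and their dimension -/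

section AffineSets

/-- A function on affine space given by a polynomial. -/
def IsPolyFun {K : Type*} [Field K] {κ : Type*} (f : (κ → K) → K) : Prop :=
  ∃ p : MvPolynomial κ K, ∀ x, f x = eval x p

namespace IsPolyFun

variable {K : Type*} [Field K] {κ : Type*} {f g : (κ → K) → K}

theorem coord (i : κ) : IsPolyFun fun x : κ → K => x i := ⟨X i, fun x => by simp⟩

theorem const (c : K) : IsPolyFun fun _ : κ → K => c := ⟨C c, fun x => by simp⟩

theorem eval_poly (p : MvPolynomial κ K) : IsPolyFun fun x => eval x p := ⟨p, fun _ => rfl⟩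

theorem add (hf : IsPolyFun f) (hg : IsPolyFun g) : IsPolyFun fun x => f x + g x := by
  obtain ⟨p, hp⟩ := hf
  obtain ⟨q, hq⟩ := hg
  exact ⟨p + q, fun x => by simp [hp, hq]⟩

theorem mul (hf : IsPolyFun f) (hg : IsPolyFun g) : IsPolyFun fun x => f x * g x := by
  obtain ⟨p, hp⟩ := hf
  obtain ⟨q, hq⟩ := hg
  exact ⟨p * q, fun x => by simp [hp, hq]⟩

theorem sum {α : Type*} {s : Finset α} {f : α → (κ → K) → K} (h : ∀ a, IsPolyFun (f a)) :
    IsPolyFun fun x => ∑ a ∈ s, f a x := by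
  choose p hp using h
  exact ⟨∑ a ∈ s, p a, fun x => by simp [hp]⟩

theorem prod {α : Type*} {s : Finset α} {f : α → (κ → K) → K} (h : ∀ a, IsPolyFun (f a)) :
    IsPolyFun fun x => ∏ a ∈ s, f a x := by
  choose p hp using h
  exact ⟨∏ a ∈ s, p a, fun x => by simp [hp, map_prod]⟩

theorem multiset_prod {α : Type*} {s : Multiset α} {f : α → (κ → K) → K}
    (h : ∀ a, IsPolyFun (f a)) : IsPolyFun fun x => (s.map fun a => f a x).prod := by
  choose p hp using h
  exact ⟨(s.map p).prod, fun x => by simp [hp, map_multiset_prod]⟩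

theorem det {m : Type*} [Fintype m] [DecidableEq m] {M : m → m → (κ → K) → K}
    (h : ∀ a b, IsPolyFun (M a b)) :
    IsPolyFun fun x => (Matrix.of fun a b => M a b x).det := by
  simp only [Matrix.det_apply']
  exact sum fun σ => mul (const _) (prod fun a => h _ _)

/-- Substitution of polynomial functions into a polynomial. -/
theorem comp {ι : Type*} {φ : (κ → K) → ι → K} (hφ : ∀ i, IsPolyFun fun x => φ x i)
    {F : (ι → K) → K} (hF : IsPolyFun F) : IsPolyFun fun x => F (φ x) := by
  choose p hp using hφ
  obtain ⟨q, hq⟩ := hF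
  refine ⟨bind₁ p q, fun x => ?_⟩
  change F (φ x) = eval x (bind₁ p q)
  rw [hq]
  rw [show eval x (bind₁ p q) = aeval x (bind₁ p q) by rw [aeval_eq_eval], aeval_bind₁,
    aeval_eq_eval]
  simp only [aeval_eq_eval, ← hp]

end IsPolyFun

variable {K : Type*} [Field K] {ι κ : Type}

theorem mem_vanishingIdeal {C : Set (ι → K)} {f : MvPolynomial ι K} :
    f ∈ vanishingIdeal K C ↔ ∀ x ∈ C, eval x f = 0 := by
  simp [mem_vanishingIdeal_iff, aeval_eq_eval]

/-- The dimension of the Zariski closure of an irreducible set of points of affine space. -/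
def affDim (C : Set (ι → K)) : ℕ :=
  (Algebra.trdeg K (MvPolynomial ι K ⧸ vanishingIdeal K C)).toNat

/-- Irreducibility as the meeting of nonempty basic open sets. All later general-point arguments use
this form. -/
theorem isPrime_vanishingIdeal_iff {C : Set (ι → K)} :
    (vanishingIdeal K C).IsPrime ↔ C.Nonempty ∧ ∀ f g : (ι → K) → K, IsPolyFun f → IsPolyFun g →
      (∃ x ∈ C, f x ≠ 0) → (∃ x ∈ C, g x ≠ 0) → ∃ x ∈ C, f x ≠ 0 ∧ g x ≠ 0 := by
  constructor
  · intro h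
    constructor
    · by_contra hC
      rw [Set.not_nonempty_iff_eq_empty] at hC
      exact h.ne_top (by rw [hC, vanishingIdeal_empty])
    · rintro f g ⟨p, hp⟩ ⟨q, hq⟩ ⟨x, hx, hfx⟩ ⟨y, hy, hgy⟩
      by_contra! hcon
      have : p * q ∈ vanishingIdeal K C := by
        rw [mem_vanishingIdeal]
        intro z hz
        rw [map_mul, ← hp, ← hq]
        by_cases hz0 : f z = 0
        · rw [hz0, zero_mul]
        · rw [hcon z hz hz0, mul_zero]
      rcases h.mem_or_mem this with h1 | h1
      · exact hfx (by rw [hp]; exact mem_vanishingIdeal.mp h1 x hx)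
      · exact hgy (by rw [hq]; exact mem_vanishingIdeal.mp h1 y hy)
  · rintro ⟨⟨x, hx⟩, h⟩
    refine ⟨?_, ?_⟩
    · rw [Ideal.ne_top_iff_one, mem_vanishingIdeal]
      intro h1
      simpa using h1 x hx
    · intro p q hpq
      by_contra! hcon
      simp only [mem_vanishingIdeal, not_forall] at hcon hpq
      obtain ⟨⟨x, hx, hpx⟩, ⟨y, hy, hqy⟩⟩ := hcon
      obtain ⟨z, hz, h1, h2⟩ := h _ _ (.eval_poly p) (.eval_poly q) ⟨x, hx, hpx⟩ ⟨y, hy, hqy⟩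
      have := hpq z hz
      rw [map_mul] at this
      exact mul_ne_zero h1 h2 this

theorem exists_vanishingIdeal_image {φ : (κ → K) → ι → K} (hφ : ∀ i, IsPolyFun fun x => φ x i) :
    ∃ h : MvPolynomial ι K →ₐ[K] MvPolynomial κ K,
      ∀ C, vanishingIdeal K (φ '' C) = (vanishingIdeal K C).comap h := by
  choose p hp using hφ
  refine ⟨bind₁ p, fun C => ?_⟩
  ext f
  rw [Ideal.mem_comap, mem_vanishingIdeal, mem_vanishingIdeal, Set.forall_mem_image]
  refine forall₂_congr fun x _ => ?_
  rw [show eval x (bind₁ p f) = aeval x (bind₁ p f) by rw [aeval_eq_eval], aeval_bind₁,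
    aeval_eq_eval]
  simp only [aeval_eq_eval, ← hp]

theorem isPrime_image {φ : (κ → K) → ι → K} (hφ : ∀ i, IsPolyFun fun x => φ x i)
    {C : Set (κ → K)} (hC : (vanishingIdeal K C).IsPrime) :
    (vanishingIdeal K (φ '' C)).IsPrime := by
  obtain ⟨h, hh⟩ := exists_vanishingIdeal_image hφ
  rw [hh]
  exact Ideal.comap_isPrime _ _

theorem affDim_congr {C D : Set (ι → K)} (h : vanishingIdeal K C = vanishingIdeal K D) :
    affDim C = affDim D := by
  rw [affDim, affDim, h]

theorem trdeg_coordRing_lt_aleph0 [Finite ι] (C : Set (ι → K)) :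
    Algebra.trdeg K (MvPolynomial ι K ⧸ vanishingIdeal K C) < Cardinal.aleph0 :=
  _root_.trdeg_lt_aleph0_of_finiteType

theorem ringKrullDim_coordRing [Finite ι] {C : Set (ι → K)} (hC : (vanishingIdeal K C).IsPrime) :
    ringKrullDim (MvPolynomial ι K ⧸ vanishingIdeal K C) = (affDim C : ℕ) :=
  ringKrullDim_eq_trdeg K _

theorem affDim_mono [Finite ι] {C D : Set (ι → K)} (h : C ⊆ D) : affDim C ≤ affDim D := by
  refine Cardinal.toNat_le_toNat ?_ (trdeg_coordRing_lt_aleph0 D)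
  exact trdeg_le_of_surjective (Ideal.Quotient.factorₐ K (vanishingIdeal_anti_mono h))
    (Ideal.Quotient.factor_surjective (vanishingIdeal_anti_mono h))

theorem affDim_image_le [Finite ι] [Finite κ] {φ : (κ → K) → ι → K}
    (hφ : ∀ i, IsPolyFun fun x => φ x i) (C : Set (κ → K)) : affDim (φ '' C) ≤ affDim C := by
  obtain ⟨h, hh⟩ := exists_vanishingIdeal_image hφ
  have h1 : vanishingIdeal K (φ '' C) ≤ (vanishingIdeal K C).comap h := (hh C).le
  have h2 := trdeg_le_of_injective (Ideal.quotientMapₐ (vanishingIdeal K C) h h1)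
    (Ideal.quotientMap_injective' (H := h1) (hh C).ge)
  exact Cardinal.toNat_le_toNat h2 (trdeg_coordRing_lt_aleph0 C)

/-- The product of two sets of points. -/
def prodSet (C : Set (ι → K)) (D : Set (κ → K)) : Set (ι ⊕ κ → K) :=
  {z | (fun i => z (.inl i)) ∈ C ∧ (fun j => z (.inr j)) ∈ D}

theorem elim_mem_prodSet {C : Set (ι → K)} {D : Set (κ → K)} {x : ι → K} {y : κ → K} (hx : x ∈ C)
    (hy : y ∈ D) : Sum.elim x y ∈ prodSet C D := ⟨hx, hy⟩

/-- Given `f(x₁, ·) ≠ 0` and `g(x₂, ·) ≠ 0`, irreducibility of `D` yields one `y` good for both;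
irreducibility of `C` then yields one `x`. Working with points avoids tensor products of domains. -/
theorem isPrime_prodSet {C : Set (ι → K)} {D : Set (κ → K)} (hC : (vanishingIdeal K C).IsPrime)
    (hD : (vanishingIdeal K D).IsPrime) : (vanishingIdeal K (prodSet C D)).IsPrime := by
  rw [isPrime_vanishingIdeal_iff] at hC hD ⊢
  obtain ⟨⟨x, hx⟩, hC⟩ := hC
  obtain ⟨⟨y, hy⟩, hD⟩ := hD
  refine ⟨⟨_, elim_mem_prodSet hx hy⟩, ?_⟩
  have split : ∀ z : ι ⊕ κ → K, Sum.elim (fun i => z (.inl i)) (fun j => z (.inr j)) = z :=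
    fun z => by ext (i | j) <;> rfl
  rintro f g hf hg ⟨z, ⟨hz1, hz2⟩, hfz⟩ ⟨w, ⟨hw1, hw2⟩, hgw⟩
  have hr : ∀ F : (ι ⊕ κ → K) → K, IsPolyFun F → ∀ x : ι → K, IsPolyFun fun y => F (Sum.elim x y) :=
    fun F hF x => IsPolyFun.comp (φ := fun y => Sum.elim x y)
      (by rintro (i | j); exacts [.const _, .coord j]) hF
  have hl : ∀ F : (ι ⊕ κ → K) → K, IsPolyFun F → ∀ y : κ → K, IsPolyFun fun x => F (Sum.elim x y) :=
    fun F hF y => IsPolyFun.comp (φ := fun x => Sum.elim x y)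
      (by rintro (i | j); exacts [.coord i, .const _]) hF
  obtain ⟨y, hy, hy1, hy2⟩ := hD _ _ (hr f hf fun i => z (.inl i)) (hr g hg fun i => w (.inl i))
    ⟨_, hz2, by rwa [split]⟩ ⟨_, hw2, by rwa [split]⟩
  obtain ⟨x, hx, hx1, hx2⟩ := hC _ _ (hl f hf y) (hl g hg y) ⟨_, hz1, hy1⟩ ⟨_, hw1, hy2⟩
  exact ⟨_, elim_mem_prodSet hx hy, hx1, hx2⟩

/-- Noether normalizations of the two factors combine to a map from a polynomial ring in `affDim C +
affDim D` variables over which the coordinate ring of the product is integral. Only this upper bound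
is needed. -/
theorem affDim_prodSet_le [Finite ι] [Finite κ] {C : Set (ι → K)} {D : Set (κ → K)}
    (hC : (vanishingIdeal K C).IsPrime) (hD : (vanishingIdeal K D).IsPrime) :
    affDim (prodSet C D) ≤ affDim C + affDim D := by
  have hP := isPrime_prodSet hC hD
  obtain ⟨g₁, -, h₁⟩ := exists_isIntegral_mvPolynomial K (MvPolynomial ι K ⧸ vanishingIdeal K C)
  obtain ⟨g₂, -, h₂⟩ := exists_isIntegral_mvPolynomial K (MvPolynomial κ K ⧸ vanishingIdeal K D)
  let B := MvPolynomial (ι ⊕ κ) K ⧸ vanishingIdeal K (prodSet C D)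
  let f₁ : (MvPolynomial ι K ⧸ vanishingIdeal K C) →ₐ[K] B :=
    Ideal.quotientMapₐ _ (rename Sum.inl) (by
      intro p hp
      rw [Ideal.mem_comap, mem_vanishingIdeal]
      rintro z ⟨hz, -⟩
      change eval z (rename Sum.inl p) = 0
      rw [eval_rename]
      exact mem_vanishingIdeal.mp hp _ hz)
  let f₂ : (MvPolynomial κ K ⧸ vanishingIdeal K D) →ₐ[K] B :=
    Ideal.quotientMapₐ _ (rename Sum.inr) (by
      intro p hp
      rw [Ideal.mem_comap, mem_vanishingIdeal]
      rintro z ⟨-, hz⟩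
      change eval z (rename Sum.inr p) = 0
      rw [eval_rename]
      exact mem_vanishingIdeal.mp hp _ hz)
  let h : MvPolynomial (Fin (affDim C) ⊕ Fin (affDim D)) K →ₐ[K] B :=
    aeval (Sum.elim (fun i => f₁ (g₁ (X i))) (fun j => f₂ (g₂ (X j))))
  have hint : h.toRingHom.IsIntegral := by
    let _ := h.toRingHom.toAlgebra
    have e₁ : ∀ a, IsIntegral (MvPolynomial (Fin (affDim C) ⊕ Fin (affDim D)) K) (f₁ a) := by
      intro a
      let _ : Algebra (MvPolynomial (Fin (affDim C)) K) (MvPolynomial ι K ⧸ vanishingIdeal K C) :=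
        g₁.toRingHom.toAlgebra
      refine IsIntegral.map_of_comp_eq (R := MvPolynomial (Fin (affDim C)) K)
        (rename Sum.inl : _ →ₐ[K] _).toRingHom f₁.toRingHom ?_ (h₁ a)
      have : h.comp (rename Sum.inl) = f₁.comp g₁ := by
        ext i
        simp [h]
        rfl
      exact congrArg AlgHom.toRingHom this
    have e₂ : ∀ a, IsIntegral (MvPolynomial (Fin (affDim C) ⊕ Fin (affDim D)) K) (f₂ a) := by
      intro a
      let _ : Algebra (MvPolynomial (Fin (affDim D)) K) (MvPolynomial κ K ⧸ vanishingIdeal K D) :=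
        g₂.toRingHom.toAlgebra
      refine IsIntegral.map_of_comp_eq (R := MvPolynomial (Fin (affDim D)) K)
        (rename Sum.inr : _ →ₐ[K] _).toRingHom f₂.toRingHom ?_ (h₂ a)
      have : h.comp (rename Sum.inr) = f₂.comp g₂ := by
        ext i
        simp [h]
        rfl
      exact congrArg AlgHom.toRingHom this
    intro b
    obtain ⟨p, rfl⟩ := Ideal.Quotient.mk_surjective b
    change IsIntegral (MvPolynomial (Fin (affDim C) ⊕ Fin (affDim D)) K) _
    induction p using MvPolynomial.induction_on with
    | C c =>
      have : (Ideal.Quotient.mk (vanishingIdeal K (prodSet C D))) (MvPolynomial.C c) =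
          algebraMap (MvPolynomial (Fin (affDim C) ⊕ Fin (affDim D)) K) B (MvPolynomial.C c) := by
        change _ = h (MvPolynomial.C c)
        rw [algHom_C]
        rfl
      rw [this]
      exact isIntegral_algebraMap
    | add p q hp hq => rw [map_add]; exact hp.add hq
    | mul_X p i hp =>
      rw [map_mul]
      refine hp.mul ?_
      rcases i with i | j
      · convert! e₁ (Ideal.Quotient.mk _ (X i))
        change _ = Ideal.Quotient.mk _ (rename Sum.inl (X i))
        rw [rename_X]
      · convert! e₂ (Ideal.Quotient.mk _ (X j))
        change _ = Ideal.Quotient.mk _ (rename Sum.inr (X j))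
        rw [rename_X]
  have := trdeg_le_of_isIntegral h hint
  simpa [affDim, B] using this

/-- The `m`-fold product of a set of points. -/
def powSet (m : ℕ) (C : Set (ι → K)) : Set (Fin m × ι → K) :=
  {z | ∀ i, (fun b => z (i, b)) ∈ C}

theorem isPrime_vanishingIdeal_singleton (x : ι → K) : (vanishingIdeal K {x}).IsPrime :=
  inferInstance

theorem isPrime_powSet (m : ℕ) {C : Set (ι → K)} (hC : (vanishingIdeal K C).IsPrime) :
    (vanishingIdeal K (powSet m C)).IsPrime := by
  induction m with
  | zero =>
    have : powSet 0 C = {fun z => z.1.elim0} := by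
      ext z
      simp only [powSet, IsEmpty.forall_iff, Set.ofPred_true, Set.mem_univ, Set.mem_singleton_iff,
        true_iff]
      ext z
      exact z.1.elim0
    rw [this]
    exact isPrime_vanishingIdeal_singleton _
  | succ m ih =>
    let φ : ((Fin m × ι) ⊕ ι → K) → Fin (m + 1) × ι → K := fun z ib =>
      Fin.cases (motive := fun _ => K) (z (.inr ib.2)) (fun i => z (.inl (i, ib.2))) ib.1
    have hφ : ∀ i, IsPolyFun fun x => φ x i := by
      rintro ⟨i, b⟩
      refine Fin.cases ?_ (fun i => ?_) i
      · exact .coord (Sum.inr b)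
      · exact .coord (Sum.inl (i, b))
    have : powSet (m + 1) C = φ '' prodSet (powSet m C) C := by
      ext z
      constructor
      · intro hz
        refine ⟨Sum.elim (fun ib => z (ib.1.succ, ib.2)) (fun b => z (0, b)), ⟨fun i => hz i.succ,
            hz 0⟩, ?_⟩
        ext ⟨i, b⟩
        refine Fin.cases ?_ (fun i => ?_) i <;> rfl
      · rintro ⟨w, ⟨hw1, hw2⟩, rfl⟩ i
        refine Fin.cases ?_ (fun i => ?_) i
        · exact hw2
        · exact hw1 i
    rw [this]
    exact isPrime_image hφ (isPrime_prodSet ih hC)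

theorem vanishingIdeal_univ [Infinite K] : vanishingIdeal K (Set.univ : Set (ι → K)) = ⊥ := by
  rw [eq_bot_iff]
  intro f hf
  rw [mem_vanishingIdeal] at hf
  exact MvPolynomial.funext fun x => by simp [hf x]

theorem isPrime_univ [Infinite K] : (vanishingIdeal K (Set.univ : Set (ι → K))).IsPrime := by
  rw [vanishingIdeal_univ]
  exact Ideal.isPrime_bot

theorem affDim_univ [Infinite K] [Finite ι] : affDim (Set.univ : Set (ι → K)) = Nat.card ι := by
  have h := ringKrullDim_coordRing (isPrime_univ (K := K) (ι := ι))
  rw [vanishingIdeal_univ, ringKrullDim_eq_of_ringEquiv (RingEquiv.quotientBot _),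
    MvPolynomial.ringKrullDim_of_isNoetherianRing, ringKrullDim_eq_zero_of_field, zero_add] at h
  exact_mod_cast h.symm

end AffineSets

/-! ### Affine cones and the projective Zariski topology -/

section Cones

variable {K : Type*} [Field K] {ι : Type}

theorem eval_smul_of_isHomogeneous {f : MvPolynomial ι K} {d : ℕ} (hf : f.IsHomogeneous d) (t : K)
    (v : ι → K) : eval (t • v) f = t ^ d * eval v f := by
  rw [eval_eq, eval_eq, Finset.mul_sum]
  refine Finset.sum_congr rfl fun m hm => ?_
  have hd : ∑ i ∈ m.support, m i = d := by
    have h₁ := hf (mem_support_iff.mp hm)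
    have h₂ := DFunLike.congr_fun (Finsupp.degree_eq_weight_one (R := ℕ) (σ := ι)) m
    exact h₂.trans h₁
  simp only [Pi.smul_apply, smul_eq_mul, mul_pow, Finset.prod_mul_distrib,
      Finset.prod_pow_eq_pow_sum, hd]
  ring

theorem eval_smul_eq_sum (f : MvPolynomial ι K) (t : K) (v : ι → K) :
    eval (t • v) f =
      ∑ d ∈ Finset.range (f.totalDegree + 1), t ^ d * eval v (homogeneousComponent d f) := by
  conv_lhs => rw [← sum_homogeneousComponent f, map_sum]
  exact Finset.sum_congr rfl fun d _ =>
    eval_smul_of_isHomogeneous (homogeneousComponent_isHomogeneous d f) t v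

/-- The restriction of a polynomial to the line through a vector. -/
def lineRestrict (f : MvPolynomial ι K) (v : ι → K) : Polynomial K :=
  ∑ d ∈ Finset.range (f.totalDegree + 1),
    Polynomial.monomial d (eval v (homogeneousComponent d f))

theorem eval_lineRestrict (f : MvPolynomial ι K) (v : ι → K) (t : K) :
    (lineRestrict f v).eval t = eval (t • v) f := by
  rw [eval_smul_eq_sum, lineRestrict, Polynomial.eval_finsetSum]
  exact Finset.sum_congr rfl fun d _ => by rw [Polynomial.eval_monomial, mul_comm]

theorem lineRestrict_eq_zero_iff (f : MvPolynomial ι K) (v : ι → K) :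
    lineRestrict f v = 0 ↔ ∀ d, eval v (homogeneousComponent d f) = 0 := by
  have hc : ∀ d, (lineRestrict f v).coeff d =
      if d < f.totalDegree + 1 then eval v (homogeneousComponent d f) else 0 := by
    intro d
    simp [lineRestrict, Polynomial.coeff_monomial]
  constructor
  · intro h d
    have := hc d
    rw [h, Polynomial.coeff_zero] at this
    split_ifs at this with hd
    · exact this.symm
    · rw [homogeneousComponent_eq_zero _ _ (by omega), map_zero]
  · intro h
    ext d
    rw [hc, h]
    simp

theorem lineRestrict_eq_zero_of_forall_ne [Infinite K] {f : MvPolynomial ι K} {v : ι → K}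
    (h : ∀ t : K, t ≠ 0 → eval (t • v) f = 0) : lineRestrict f v = 0 := by
  refine Polynomial.eq_zero_of_infinite_isRoot _ (Set.Infinite.mono ?_ (Set.finite_singleton (0 :
      K)).infinite_compl)
  intro t ht
  change (lineRestrict f v).eval t = 0
  rw [eval_lineRestrict]
  exact h t ht

/-- The affine cone over a set of points of projective space, including the vertex. -/
def cone (Y : Set (ℙ K (ι → K))) : Set (ι → K) :=
  {v | ∀ h : v ≠ 0, Projectivization.mk K v h ∈ Y}

theorem mk_smul {v : ι → K} {t : K} (_ht : t ≠ 0) (hv : v ≠ 0) (h : t • v ≠ 0) :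
    Projectivization.mk K (t • v) h = Projectivization.mk K v hv :=
  (Projectivization.mk_eq_mk_iff' K _ _ _ _).mpr ⟨t, rfl⟩

theorem zero_mem_cone (Y : Set (ℙ K (ι → K))) : (0 : ι → K) ∈ cone Y := fun h => absurd rfl h

theorem smul_mem_cone {Y : Set (ℙ K (ι → K))} {v : ι → K} (hv : v ∈ cone Y) (t : K) :
    t • v ∈ cone Y := by
  intro h
  have ht : t ≠ 0 := left_ne_zero_of_smul h
  have hv0 : v ≠ 0 := right_ne_zero_of_smul h
  rw [mk_smul ht hv0]
  exact hv hv0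

theorem mem_cone_iff {Y : Set (ℙ K (ι → K))} {v : ι → K} (hv : v ≠ 0) :
    v ∈ cone Y ↔ Projectivization.mk K v hv ∈ Y := ⟨fun h => h hv, fun h _ => h⟩

theorem rep_mem_cone {Y : Set (ℙ K (ι → K))} {p : ℙ K (ι → K)} : p.rep ∈ cone Y ↔ p ∈ Y := by
  rw [mem_cone_iff p.rep_nonzero, Projectivization.mk_rep]

theorem cone_mono {Y Z : Set (ℙ K (ι → K))} (h : Y ⊆ Z) : cone Y ⊆ cone Z :=
  fun _ hv h0 => h (hv h0)

theorem eval_rep_mk {f : MvPolynomial ι K} {d : ℕ} (hf : f.IsHomogeneous d) {v : ι → K}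
    (hv : v ≠ 0) : eval (Projectivization.mk K v hv).rep f = 0 ↔ eval v f = 0 := by
  obtain ⟨a, ha⟩ := Projectivization.exists_smul_eq_mk_rep K v hv
  rw [← ha, Units.smul_def, eval_smul_of_isHomogeneous hf]
  simp

theorem isClosed_iff_exists {Z : Set (ℙ K (ι → K))} :
    IsClosed Z ↔ ∃ S : Set (MvPolynomial ι K), (∀ f ∈ S, ∃ d : ℕ, f.IsHomogeneous d) ∧
      Z = zeroLocus S := by
  rw [← isOpen_compl_iff]
  change Zᶜᶜ ∈ _ ↔ _
  rw [compl_compl]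
  rfl

theorem isClosed_zeroLocus {S : Set (MvPolynomial ι K)}
    (hS : ∀ f ∈ S, ∃ d : ℕ, f.IsHomogeneous d) : IsClosed (zeroLocus S) :=
  isClosed_iff_exists.mpr ⟨S, hS, rfl⟩

theorem mem_closure_iff_eval {W : Set (ℙ K (ι → K))} {p : ℙ K (ι → K)} :
    p ∈ closure W ↔ ∀ (f : MvPolynomial ι K) (d : ℕ), f.IsHomogeneous d →
      (∀ q ∈ W, eval q.rep f = 0) → eval p.rep f = 0 := by
  constructor
  · intro hp f d hf hW
    have hc : IsClosed (zeroLocus {f}) := isClosed_zeroLocus (by rintro _ rfl; exact ⟨d, hf⟩)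
    have hsub : W ⊆ zeroLocus {f} := by
      rintro q hq g rfl
      exact hW q hq
    exact closure_minimal hsub hc hp f rfl
  · intro h
    obtain ⟨S, hS, hSW⟩ := isClosed_iff_exists.mp (isClosed_closure (s := W))
    rw [hSW]
    intro f hf
    obtain ⟨d, hd⟩ := hS f hf
    refine h f d hd fun q hq => ?_
    have : q ∈ zeroLocus S := hSW ▸ subset_closure hq
    exact this f hf

/-- The points on whose lines a polynomial vanishes form a closed set. -/
theorem isClosed_lineRestrict_eq_zero (f : MvPolynomial ι K) :
    IsClosed {p : ℙ K (ι → K) | lineRestrict f p.rep = 0} := by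
  convert isClosed_zeroLocus (S := Set.range fun d => homogeneousComponent d f)
    (by rintro _ ⟨d, rfl⟩; exact ⟨d, homogeneousComponent_isHomogeneous d f⟩) using 1
  ext p
  simp [zeroLocus, lineRestrict_eq_zero_iff]

/-- Restriction to lines makes the vanishing of an arbitrary, possibly inhomogeneous, polynomial on
the cone a closed condition on points of projective space. -/
theorem mem_vanishingIdeal_cone [Infinite K] {Y : Set (ℙ K (ι → K))} (hY : Y.Nonempty)
    {f : MvPolynomial ι K} :
    f ∈ vanishingIdeal K (cone Y) ↔ ∀ p ∈ Y, lineRestrict f p.rep = 0 := by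
  rw [mem_vanishingIdeal]
  constructor
  · intro h p hp
    exact lineRestrict_eq_zero_of_forall_ne fun t _ => h _ (smul_mem_cone (rep_mem_cone.mpr hp) t)
  · intro h v hv
    by_cases hv0 : v = 0
    · obtain ⟨p, hp⟩ := hY
      have := eval_lineRestrict f p.rep 0
      rw [h p hp, Polynomial.eval_zero, zero_smul] at this
      rw [hv0, ← this]
    · obtain ⟨a, ha⟩ := Projectivization.exists_smul_eq_mk_rep K v hv0
      have := eval_lineRestrict f (Projectivization.mk K v hv0).rep (a⁻¹ : Kˣ)
      rw [h _ (hv hv0), Polynomial.eval_zero, ← ha, ← Units.smul_def, inv_smul_smul] at this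
      exact this.symm

theorem vanishingIdeal_cone_closure [Infinite K] {Y : Set (ℙ K (ι → K))} (hY : Y.Nonempty) :
    vanishingIdeal K (cone (closure Y)) = vanishingIdeal K (cone Y) := by
  apply le_antisymm (vanishingIdeal_anti_mono (cone_mono subset_closure))
  intro f hf
  rw [mem_vanishingIdeal_cone hY] at hf
  rw [mem_vanishingIdeal_cone hY.closure]
  have hsub : closure Y ⊆ {p | lineRestrict f p.rep = 0} :=
    closure_minimal hf (isClosed_lineRestrict_eq_zero f)
  exact fun p hp => hsub hp

/-- If `f * g` vanishes on the cone, then on each line one factor restricts to zero, since `K[t]` is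
a domain. This covers `Y` by two closed sets. -/
theorem isPrime_cone_of_isIrreducible [Infinite K] {Y : Set (ℙ K (ι → K))} (hY : IsIrreducible Y) :
    (vanishingIdeal K (cone Y)).IsPrime := by
  refine ⟨?_, ?_⟩
  · rw [Ideal.ne_top_iff_one, mem_vanishingIdeal]
    intro h
    simpa using h 0 (zero_mem_cone Y)
  · intro f g hfg
    simp only [mem_vanishingIdeal_cone hY.nonempty]
    have hcov : Y ⊆ {p | lineRestrict f p.rep = 0} ∪ {p | lineRestrict g p.rep = 0} := by
      intro p hp
      have : lineRestrict f p.rep * lineRestrict g p.rep = 0 := by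
        apply Polynomial.funext
        intro t
        rw [Polynomial.eval_mul, eval_lineRestrict, eval_lineRestrict, Polynomial.eval_zero, ←
            map_mul]
        exact mem_vanishingIdeal.mp hfg _ (smul_mem_cone (rep_mem_cone.mpr hp) t)
      exact mul_eq_zero.mp this
    exact isPreirreducible_iff_isClosed_union_isClosed.mp hY.isPreirreducible _ _
      (isClosed_lineRestrict_eq_zero f) (isClosed_lineRestrict_eq_zero g) hcov

theorem isIrreducible_of_forall_homogeneous {W : Set (ℙ K (ι → K))} (hW : W.Nonempty)
    (h : ∀ (f g : MvPolynomial ι K) (a b : ℕ), f.IsHomogeneous a → g.IsHomogeneous b →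
      (∀ p ∈ W, eval p.rep f * eval p.rep g = 0) →
        (∀ p ∈ W, eval p.rep f = 0) ∨ ∀ p ∈ W, eval p.rep g = 0) : IsIrreducible W := by
  refine ⟨hW, isPreirreducible_iff_isClosed_union_isClosed.mpr fun Z₁ Z₂ h₁ h₂ hcov => ?_⟩
  obtain ⟨S, hS, rfl⟩ := isClosed_iff_exists.mp h₁
  obtain ⟨T, hT, rfl⟩ := isClosed_iff_exists.mp h₂
  by_contra! hcon
  simp only [Set.not_subset, zeroLocus, Set.mem_ofPred_eq, not_forall] at hcon
  obtain ⟨⟨p, hp, f, hf, hfp⟩, ⟨q, hq, g, hg, hgq⟩⟩ := hcon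
  obtain ⟨a, ha⟩ := hS f hf
  obtain ⟨b, hb⟩ := hT g hg
  rcases h f g a b ha hb (fun r hr => by
    rcases hcov hr with h1 | h1
    · rw [h1 f hf, zero_mul]
    · rw [h1 g hg, mul_zero]) with h1 | h1
  · exact hfp (h1 p hp)
  · exact hgq (h1 q hq)

theorem vanishingIdeal_cone_strictAnti [Infinite K] {Y Z : Set (ℙ K (ι → K))} (hY : Y.Nonempty)
    (hYc : IsClosed Y) (h : Y ⊂ Z) : vanishingIdeal K (cone Z) < vanishingIdeal K (cone Y) := by
  refine lt_of_le_not_ge (vanishingIdeal_anti_mono (cone_mono h.1)) fun hle => ?_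
  obtain ⟨p, hpZ, hpY⟩ := Set.exists_of_ssubset h
  obtain ⟨S, hS, rfl⟩ := isClosed_iff_exists.mp hYc
  simp only [zeroLocus, Set.mem_ofPred_eq, not_forall] at hpY
  obtain ⟨f, hf, hfp⟩ := hpY
  have : f ∈ vanishingIdeal K (cone (zeroLocus S)) := by
    rw [mem_vanishingIdeal_cone hY]
    intro q hq
    obtain ⟨d, hd⟩ := hS f hf
    refine lineRestrict_eq_zero_of_forall_ne fun t _ => ?_
    rw [eval_smul_of_isHomogeneous hd, hq f hf, mul_zero]
  exact hfp (mem_vanishingIdeal.mp (hle this) _ (rep_mem_cone.mpr hpZ))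

theorem vanishingIdeal_cone_lt_zero [Infinite K] {Y : Set (ℙ K (ι → K))} (hY : Y.Nonempty) :
    vanishingIdeal K (cone Y) < vanishingIdeal K {(0 : ι → K)} := by
  refine lt_of_le_not_ge (vanishingIdeal_anti_mono (by simpa using zero_mem_cone Y)) fun hle => ?_
  obtain ⟨p, hp⟩ := hY
  obtain ⟨i, hi⟩ := Function.ne_iff.mp p.rep_nonzero
  have : (X i : MvPolynomial ι K) ∈ vanishingIdeal K {(0 : ι → K)} := by simp
  exact hi (by simpa using mem_vanishingIdeal.mp (hle this) _ (rep_mem_cone.mpr hp))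

open TopologicalSpace in
-- The cones over a chain of irreducible closed subsets give a chain of primes, which the ideal of
-- the vertex lengthens by one. The vertex is the added `⊤`.
theorem dim_add_one_le [Infinite K] [Finite ι] {Y : Set (ℙ K (ι → K))} (hY : IsIrreducible Y) :
    dim Y + 1 ≤ (affDim (cone Y) : ℕ) := by
  rw [← ringKrullDim_coordRing (isPrime_cone_of_isIrreducible hY), ringKrullDim_quotient, dim,
    topologicalKrullDim, ← Order.krullDim_orderDual]
  have hYne := hY.nonempty
  have : Nonempty (IrreducibleCloseds Y) := by
    obtain ⟨p, hp⟩ := hYne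
    exact ⟨⟨closure {⟨p, hp⟩}, isIrreducible_singleton.closure, isClosed_closure⟩⟩
  rw [← Order.krullDim_WithTop]
  let Φ : IrreducibleCloseds Y → IrreducibleCloseds (ℙ K (ι → K)) :=
    IrreducibleCloseds.map Subtype.val continuous_subtype_val
  have hΦ : StrictMono Φ := IrreducibleCloseds.map_strictMono_of_isInducing .subtypeVal
  have hΦY : ∀ Z, vanishingIdeal K (cone Y) ≤ vanishingIdeal K (cone (Φ Z : Set (ℙ K (ι → K)))) :=
      by
    intro Z
    rw [← vanishingIdeal_cone_closure hY.nonempty]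
    refine vanishingIdeal_anti_mono (cone_mono (closure_mono ?_))
    rintro _ ⟨z, -, rfl⟩
    exact z.2
  let G : WithTop (IrreducibleCloseds Y)ᵒᵈ →
      PrimeSpectrum.zeroLocus (vanishingIdeal K (cone Y) : Set (MvPolynomial ι K)) := fun Z =>
    match Z with
    | ⊤ => ⟨⟨vanishingIdeal K {0}, inferInstance⟩, (vanishingIdeal_cone_lt_zero hY.nonempty).le⟩
    | (Z : (IrreducibleCloseds Y)ᵒᵈ) => ⟨⟨vanishingIdeal K (cone (Φ (OrderDual.ofDual Z) : Set (ℙ K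
        (ι → K)))),
        isPrime_cone_of_isIrreducible (Φ (OrderDual.ofDual Z)).isIrreducible⟩, hΦY _⟩
  refine Order.krullDim_le_of_strictMono G ?_
  intro Z₁ Z₂ h
  induction Z₁ with
  | top => exact absurd h not_top_lt
  | coe Z₁ =>
    induction Z₂ with
    | top => exact vanishingIdeal_cone_lt_zero (Φ (OrderDual.ofDual Z₁)).isIrreducible.nonempty
    | coe Z₂ =>
      have h₁ : Z₁ < Z₂ := WithTop.coe_lt_coe.mp h
      have h' : OrderDual.ofDual Z₂ < OrderDual.ofDual Z₁ := h₁
      exact vanishingIdeal_cone_strictAnti (Φ (OrderDual.ofDual Z₂)).isIrreducible.nonempty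
        (Φ (OrderDual.ofDual Z₂)).isClosed (hΦ h')

end Cones

/-! ### Projective dimension through an affine chart -/

section ProjectiveDimension

variable {K : Type*} [Field K] {ι : Type}

theorem exists_homogenization (i : ι) (f : MvPolynomial ι K) :
    ∃ (F : MvPolynomial ι K) (d : ℕ), F.IsHomogeneous d ∧ ∀ v, v i = 1 → eval v F = eval v f := by
  refine ⟨∑ d ∈ Finset.range (f.totalDegree + 1), X i ^ (f.totalDegree - d) * homogeneousComponent d
      f,
    f.totalDegree, ?_, ?_⟩
  · refine IsHomogeneous.sum _ _ _ fun d hd => ?_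
    have := ((isHomogeneous_X K i).pow (f.totalDegree - d)).mul
      (homogeneousComponent_isHomogeneous d f)
    rw [Finset.mem_range] at hd
    convert this using 1
    omega
  · intro v hv
    conv_rhs => rw [← sum_homogeneousComponent f]
    simp [hv]

/-- The affine chart `x_i = 1` of a set of points of projective space. -/
def chart (i : ι) (Y : Set (ℙ K (ι → K))) : Set (ι → K) := {v | v ∈ cone Y ∧ v i = 1}

theorem inv_smul_mem_chart {i : ι} {Y : Set (ℙ K (ι → K))} {v : ι → K} (hv : v ∈ cone Y)
    (hi : v i ≠ 0) : (v i)⁻¹ • v ∈ chart i Y :=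
  ⟨smul_mem_cone hv _, by simp [hi]⟩

theorem X_notMem_vanishingIdeal_cone {i : ι} {Y : Set (ℙ K (ι → K))} {p : ℙ K (ι → K)} (hp : p ∈ Y)
    (hi : p.rep i ≠ 0) : (X i : MvPolynomial ι K) ∉ vanishingIdeal K (cone Y) := by
  intro h
  exact hi (by simpa using mem_vanishingIdeal.mp h _ (rep_mem_cone.mpr hp))

/-- If `f * g` vanishes on the chart, then `X i` times the product of the homogenizations vanishes
on the whole cone, the factor `X i` taking care of the points at infinity. The ideal of the cone is
prime and omits `X i`. -/
theorem isPrime_chart [Infinite K] {i : ι} {Y : Set (ℙ K (ι → K))} (hY : IsIrreducible Y)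
    {p : ℙ K (ι → K)} (hp : p ∈ Y) (hi : p.rep i ≠ 0) : (vanishingIdeal K (chart i Y)).IsPrime := by
  have hprime := isPrime_cone_of_isIrreducible hY
  refine ⟨?_, ?_⟩
  · rw [Ideal.ne_top_iff_one, mem_vanishingIdeal]
    intro h
    simpa using h _ (inv_smul_mem_chart (rep_mem_cone.mpr hp) hi)
  · intro f g hfg
    obtain ⟨F, a, hF, hFf⟩ := exists_homogenization i f
    obtain ⟨G, b, hG, hGg⟩ := exists_homogenization i g
    have hmem : X i * (F * G) ∈ vanishingIdeal K (cone Y) := by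
      rw [mem_vanishingIdeal]
      intro v hv
      by_cases h0 : v i = 0
      · simp [h0]
      · have hw := inv_smul_mem_chart hv h0
        have := mem_vanishingIdeal.mp hfg _ hw
        rw [map_mul, ← hFf _ hw.2, ← hGg _ hw.2, ← map_mul,
          eval_smul_of_isHomogeneous (hF.mul hG)] at this
        have := (mul_eq_zero.mp this).resolve_left (pow_ne_zero _ (inv_ne_zero h0))
        rw [map_mul, this, mul_zero]
    have key : ∀ f F : MvPolynomial ι K, (∀ v, v i = 1 → eval v F = eval v f) →
        F ∈ vanishingIdeal K (cone Y) → f ∈ vanishingIdeal K (chart i Y) := by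
      intro f F h hFm
      rw [mem_vanishingIdeal]
      intro v hv
      rw [← h v hv.2]
      exact mem_vanishingIdeal.mp hFm v hv.1
    rcases hprime.mem_or_mem
      ((hprime.mem_or_mem hmem).resolve_left (X_notMem_vanishingIdeal_cone hp hi)) with h | h
    · exact Or.inl (key f F hFf h)
    · exact Or.inr (key g G hGg h)

/-- Scaling the chart by one parameter reaches every point of the cone with nonzero `i`-th
coordinate, and these are dense in it. -/
theorem affDim_cone_le_chart [Infinite K] [Finite ι] {i : ι} {Y : Set (ℙ K (ι → K))}
    (hY : IsIrreducible Y) {p : ℙ K (ι → K)} (hp : p ∈ Y) (hi : p.rep i ≠ 0) :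
    affDim (cone Y) ≤ affDim (chart i Y) + 1 := by
  have hprime := isPrime_cone_of_isIrreducible hY
  let φ : (ι ⊕ Unit → K) → ι → K := fun z j => z (.inr ()) * z (.inl j)
  have hφ : ∀ j, IsPolyFun fun x => φ x j := fun j => (IsPolyFun.coord (Sum.inr ())).mul (.coord
      (Sum.inl j))
  have himg : vanishingIdeal K (cone Y) =
      vanishingIdeal K (φ '' prodSet (chart i Y) (Set.univ : Set (Unit → K))) := by
    apply le_antisymm
    · refine vanishingIdeal_anti_mono ?_
      rintro _ ⟨z, ⟨hz, -⟩, rfl⟩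
      exact smul_mem_cone hz.1 (z (.inr ()))
    · intro f hf
      refine (hprime.mem_or_mem (?_ : X i * f ∈ _)).resolve_left (X_notMem_vanishingIdeal_cone hp
          hi)
      rw [mem_vanishingIdeal]
      intro v hv
      by_cases h0 : v i = 0
      · simp [h0]
      · have : v ∈ φ '' prodSet (chart i Y) (Set.univ : Set (Unit → K)) := by
          refine ⟨Sum.elim ((v i)⁻¹ • v) (fun _ => v i), ⟨inv_smul_mem_chart hv h0, Set.mem_univ _⟩,
              ?_⟩
          ext j
          simp [φ, h0]
        rw [map_mul, mem_vanishingIdeal.mp hf v this, mul_zero]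
  rw [affDim_congr himg]
  refine (affDim_image_le hφ _).trans ((affDim_prodSet_le (isPrime_chart hY hp hi)
      isPrime_univ).trans ?_)
  rw [affDim_univ]
  simp

/-- Only closedness of `Y` away from the hyperplane `x_i = 0` is needed for the chart to be closed
in affine space. -/
theorem mem_chart_of_mem_zeroLocus {i : ι} {Y : Set (ℙ K (ι → K))}
    (hc : ∀ q ∈ closure Y, q.rep i ≠ 0 → q ∈ Y) {v : ι → K}
    (hv : v ∈ MvPolynomial.zeroLocus K (vanishingIdeal K (chart i Y))) : v ∈ chart i Y := by
  have hz : ∀ f ∈ vanishingIdeal K (chart i Y), eval v f = 0 := by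
    intro f hf
    rw [← aeval_eq_eval]
    exact hv f hf
  have hi : v i = 1 := by
    have := hz (X i - 1) (mem_vanishingIdeal.mpr fun w hw => by simp [hw.2])
    simpa [sub_eq_zero] using this
  have hv0 : v ≠ 0 := fun h => by simp [h] at hi
  refine ⟨fun _ => hc _ (mem_closure_iff_eval.mpr fun f d hf hfY => ?_) ?_, hi⟩
  · rw [eval_rep_mk hf]
    refine hz f (mem_vanishingIdeal.mpr fun w hw => ?_)
    have hw0 : w ≠ 0 := fun h => by simpa [h] using hw.2
    rw [← eval_rep_mk hf hw0]
    exact hfY _ (hw.1 hw0)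
  · obtain ⟨a, ha⟩ := Projectivization.exists_smul_eq_mk_rep K v hv0
    rw [← ha]
    simp [Units.smul_def, hi]

theorem isIrreducible_preimage_val {X : Type*} [TopologicalSpace X] {Y W : Set X}
    (hW : IsIrreducible W) (h : W ⊆ Y) : IsIrreducible (Subtype.val ⁻¹' W : Set Y) := by
  obtain ⟨⟨x, hx⟩, hp⟩ := hW
  refine ⟨⟨⟨x, h hx⟩, hx⟩, ?_⟩
  rintro u v hu hv ⟨y, hyW, hyu⟩ ⟨z, hzW, hzv⟩
  obtain ⟨U, hU, rfl⟩ := isOpen_induced_iff.mp hu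
  obtain ⟨V, hV, rfl⟩ := isOpen_induced_iff.mp hv
  obtain ⟨w, hw, hwU, hwV⟩ := hp U V hU hV ⟨y, hyW, hyu⟩ ⟨z, hzW, hzv⟩
  exact ⟨⟨w, h hw⟩, hw, hwU, hwV⟩

/-- The points of projective space represented by the vectors of a set. -/
def projSet (C : Set (ι → K)) : Set (ℙ K (ι → K)) :=
  {p | ∃ (v : ι → K) (h : v ≠ 0), v ∈ C ∧ Projectivization.mk K v h = p}

open TopologicalSpace in
-- By the Nullstellensatz a prime over the ideal of the chart is recovered from its zeros. Taking
-- the closure of these zeros in `Y` stays strictly monotone because inhomogeneous equations on the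
-- chart can be homogenized.
theorem ringKrullDim_chart_le [IsAlgClosed K] [Finite ι] {i : ι} {Y : Set (ℙ K (ι → K))}
    (hc : ∀ q ∈ closure Y, q.rep i ≠ 0 → q ∈ Y) :
    ringKrullDim (MvPolynomial ι K ⧸ vanishingIdeal K (chart i Y)) ≤ dim Y := by
  rw [ringKrullDim_quotient, dim, topologicalKrullDim, ← Order.krullDim_orderDual]
  let Z := PrimeSpectrum.zeroLocus (vanishingIdeal K (chart i Y) : Set (MvPolynomial ι K))
  have hsub : ∀ P : Z, ∀ v ∈ MvPolynomial.zeroLocus K P.1.asIdeal, v ∈ chart i Y := fun P v hv =>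
    mem_chart_of_mem_zeroLocus hc (zeroLocus_anti_mono P.2 hv)
  have hne : ∀ P : Z, ∀ v ∈ MvPolynomial.zeroLocus K P.1.asIdeal, v ≠ 0 := fun P v hv h => by
    simpa [h] using (hsub P v hv).2
  have hmem : ∀ (P : Z) (f : MvPolynomial ι K),
      f ∈ P.1.asIdeal ↔ ∀ v ∈ MvPolynomial.zeroLocus K P.1.asIdeal, eval v f = 0 := fun P f => by
    rw [← mem_vanishingIdeal, IsPrime.vanishingIdeal_zeroLocus]
  have hirr : ∀ P : Z, IsIrreducible (projSet (MvPolynomial.zeroLocus K P.1.asIdeal)) := by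
    intro P
    apply isIrreducible_of_forall_homogeneous
    · by_contra hemp
      refine P.1.isPrime.ne_top ((Ideal.eq_top_iff_one _).mpr ((hmem P 1).mpr fun v hv => ?_))
      exact absurd ⟨_, v, hne P v hv, hv, rfl⟩ hemp
    · intro f g a b hf hg hfg
      have key : ∀ (f : MvPolynomial ι K) (a : ℕ), f.IsHomogeneous a → (f ∈ P.1.asIdeal ↔
          ∀ p ∈ projSet (MvPolynomial.zeroLocus K P.1.asIdeal), eval p.rep f = 0) := by
        intro f a hf
        rw [hmem]
        constructor
        · rintro h _ ⟨v, hv0, hv, rfl⟩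
          rw [eval_rep_mk hf]
          exact h v hv
        · intro h v hv
          rw [← eval_rep_mk hf (hne P v hv)]
          exact h _ ⟨v, _, hv, rfl⟩
      rw [← key f a hf, ← key g b hg]
      refine P.1.isPrime.mem_or_mem ((key _ _ (hf.mul hg)).mpr fun p hp => ?_)
      rw [map_mul]
      exact hfg p hp
  have hsubY : ∀ P : Z, projSet (MvPolynomial.zeroLocus K P.1.asIdeal) ⊆ Y := by
    rintro P _ ⟨v, hv0, hv, rfl⟩
    exact (hsub P v hv).1 hv0
  have himg : ∀ P : Z, (Subtype.val '' (Subtype.val ⁻¹' projSet (MvPolynomial.zeroLocus K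
      P.1.asIdeal) : Set Y)) =
      projSet (MvPolynomial.zeroLocus K P.1.asIdeal) := fun P => by
    rw [Subtype.image_preimage_coe]
    exact Set.inter_eq_right.mpr (hsubY P)
  let G : Zᵒᵈ → IrreducibleCloseds Y := fun P =>
    { carrier := closure (Subtype.val ⁻¹' projSet (MvPolynomial.zeroLocus K (OrderDual.ofDual
        P).1.asIdeal))
      isIrreducible' := by
        exact (isIrreducible_preimage_val (hirr _) (hsubY _)).closure
      isClosed' := isClosed_closure }
  refine Order.krullDim_le_of_strictMono G ?_
  intro P' Q' hlt
  obtain ⟨P, rfl⟩ := OrderDual.toDual.surjective P'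
  obtain ⟨Q, rfl⟩ := OrderDual.toDual.surjective Q'
  have hlt' : Q < P := hlt
  refine lt_of_le_not_ge ?_ fun hge => ?_
  · refine closure_mono (Set.preimage_mono ?_)
    rintro _ ⟨v, hv0, hv, rfl⟩
    exact ⟨v, hv0, zeroLocus_anti_mono hlt'.le hv, rfl⟩
  · refine hlt'.not_ge ?_
    intro f hf
    obtain ⟨F, d, hF, hFf⟩ := exists_homogenization i f
    rw [hmem]
    intro v hv
    rw [← hFf v (hsub Q v hv).2, ← eval_rep_mk hF (hne Q v hv)]
    have h1 : (⟨_, (hsub Q v hv).1 (hne Q v hv)⟩ : Y) ∈ closure (Subtype.val ⁻¹' projSet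
        (MvPolynomial.zeroLocus K P.1.asIdeal) : Set Y) :=
      hge (subset_closure ⟨v, _, hv, rfl⟩)
    rw [closure_subtype, himg, mem_closure_iff_eval] at h1
    refine h1 F d hF ?_
    rintro _ ⟨w, hw0, hw, rfl⟩
    rw [eval_rep_mk hF, hFf w (hsub P w hw).2]
    exact (hmem P f).mp hf w hw

/-- The weak closedness hypothesis spares a proof that images of Segre and Segre–Veronese maps are
closed. -/
theorem dim_add_one [IsAlgClosed K] [Finite ι] {i : ι} {Y : Set (ℙ K (ι → K))}
    (hY : IsIrreducible Y) {p : ℙ K (ι → K)} (hp : p ∈ Y) (hi : p.rep i ≠ 0)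
    (hc : ∀ q ∈ closure Y, q.rep i ≠ 0 → q ∈ Y) : dim Y + 1 = (affDim (cone Y) : ℕ) := by
  have : Infinite K := IsAlgClosed.instInfinite
  refine le_antisymm (dim_add_one_le hY) ?_
  have h1 := affDim_cone_le_chart hY hp hi
  have h2 := ringKrullDim_chart_le hc
  rw [ringKrullDim_coordRing (isPrime_chart hY hp hi)] at h2
  calc ((affDim (cone Y) : ℕ) : WithBot ℕ∞) ≤ ((affDim (chart i Y) + 1 : ℕ) : WithBot ℕ∞) := by
        exact_mod_cast h1
    _ = (affDim (chart i Y) : ℕ) + 1 := by push_cast; rfl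
    _ ≤ dim Y + 1 := by gcongr

theorem dim_add_one_of_isClosed [IsAlgClosed K] [Finite ι] {Y : Set (ℙ K (ι → K))}
    (hY : IsIrreducible Y) (hc : IsClosed Y) : dim Y + 1 = (affDim (cone Y) : ℕ) := by
  obtain ⟨p, hp⟩ := hY.nonempty
  obtain ⟨i, hi⟩ := Function.ne_iff.mp p.rep_nonzero
  exact dim_add_one hY hp hi fun q hq _ => hc.closure_eq ▸ hq

end ProjectiveDimension

/-! ### Derivations and tangent vector fields -/

section TangentFields

/-- After Noether normalization the fraction field is separable over the rational function field,
hence formally étale over the polynomial ring. The differentials of the variables are then a basis,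
whose coordinate functionals are the partial derivatives sought. -/
theorem exists_derivations (K A : Type*) [Field K] [CharZero K] [CommRing A] [IsDomain A]
    [Algebra K A] [Algebra.FiniteType K A] :
    ∃ (D : Fin (Algebra.trdeg K A).toNat → Derivation K (FractionRing A) (FractionRing A))
      (y : Fin (Algebra.trdeg K A).toNat → A),
      ∀ i j, D i (algebraMap A _ (y j)) = if i = j then 1 else 0 := by
  obtain ⟨g, hg, hint⟩ := exists_isIntegral_mvPolynomial K A
  generalize (Algebra.trdeg K A).toNat = d at g hg hint ⊢
  let S := MvPolynomial (Fin d) K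
  let L := FractionRing A
  let F := FractionRing S
  let _ : Algebra S A := g.toRingHom.toAlgebra
  have : Algebra.IsIntegral S A := ⟨hint⟩
  have : FaithfulSMul S A := (faithfulSMul_iff_algebraMap_injective S A).mpr hg
  have : IsScalarTower K S A := IsScalarTower.of_algebraMap_eq fun c => (g.commutes c).symm
  have : IsScalarTower K S L := IsScalarTower.of_algebraMap_eq fun c => by
    rw [IsScalarTower.algebraMap_apply K A L, IsScalarTower.algebraMap_apply S A L,
      ← IsScalarTower.algebraMap_apply K S A]
  have : FaithfulSMul S L := FaithfulSMul.trans S A L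
  let _ : Algebra F L := FractionRing.liftAlgebra S L
  have : IsScalarTower S F L := FractionRing.isScalarTower_liftAlgebra S L
  have : Algebra.IsAlgebraic S A := inferInstance
  have : Algebra.IsAlgebraic F L := isAlgebraic_of_isFractionRing S A F L
  have : CharZero F := charZero_of_injective_algebraMap (R := S) (IsFractionRing.injective S F)
  have : Algebra.IsSeparable F L := inferInstance
  have : Algebra.FormallyEtale F L := Algebra.FormallyEtale.of_isSeparable F L
  have : Algebra.FormallyEtale S F := Algebra.FormallyEtale.of_isLocalization (nonZeroDivisors S)
  have : Algebra.FormallyEtale S L := Algebra.FormallyEtale.comp S F L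
  let e := KaehlerDifferential.tensorKaehlerEquivOfFormallyEtale K S L
  let b := (KaehlerDifferential.mvPolynomialBasis K (Fin d)).baseChange L
  let b' := b.map e
  refine ⟨fun i => (b'.coord i).compDer (KaehlerDifferential.D K L), fun j => g (X j), fun i j =>
      ?_⟩
  change b'.coord i (KaehlerDifferential.D K L (algebraMap A L (algebraMap S A (X j)))) = _
  rw [← IsScalarTower.algebraMap_apply S A L]
  have : KaehlerDifferential.D K L (algebraMap S L (X j)) = b' j := by
    have h₁ := KaehlerDifferential.tensorKaehlerEquivOfFormallyEtale_symm_D_algebraMap K S L (X j)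
    rw [LinearEquiv.symm_apply_eq] at h₁
    rw [h₁, Module.Basis.map_apply, Module.Basis.baseChange_apply,
        KaehlerDifferential.mvPolynomialBasis_apply]
  rw [this, Module.Basis.coord_apply, Module.Basis.repr_self, Finsupp.single_apply]
  simp [eq_comm]

theorem derivation_aeval {K A M ι : Type*} [Field K] [CommRing A] [Algebra K A] [AddCommGroup M]
    [Module K M] [Module A M] [IsScalarTower K A M] [Fintype ι] (D : Derivation K A M) (x : ι → A)
        (p : MvPolynomial ι K) :
    D (aeval x p) = ∑ i, aeval x (pderiv i p) • D (x i) := by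
  classical
  induction p using MvPolynomial.induction_on with
  | C c => simp
  | add p q hp hq => simp [hp, hq, add_smul, Finset.sum_add_distrib]
  | mul_X p j hp =>
    rw [map_mul, Derivation.leibniz, hp, aeval_X]
    simp only [Derivation.leibniz, map_add, smul_eq_mul, map_mul, aeval_X, add_smul,
      Finset.sum_add_distrib, Finset.smul_sum, pderiv_X, mul_smul]
    congr 1
    simp [Pi.single_apply, apply_ite, ite_smul]

/-- Every Taylor coefficient at `0` is, up to a factor invertible in characteristic zero, the value
at `0` of an iterated derivative, which is again in `J`. -/
theorem eq_zero_of_pderiv_stable {K ι : Type*} [Field K] [CharZero K]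
    {J : Set (MvPolynomial ι K)} (h0 : ∀ f ∈ J, eval 0 f = 0)
    (hJ : ∀ f ∈ J, ∀ i, pderiv i f ∈ J) {f : MvPolynomial ι K} (hf : f ∈ J) : f = 0 := by
  have key : ∀ (n : ℕ) (m : ι →₀ ℕ), m.degree = n → ∀ f ∈ J, coeff m f = 0 := by
    intro n
    induction n with
    | zero =>
      intro m hm f hf
      rw [Finsupp.degree_eq_zero_iff] at hm
      rw [hm, ← constantCoeff_eq, ← eval_zero]
      exact h0 f hf
    | succ n ih =>
      intro m hm f hf
      obtain ⟨i, hi⟩ : ∃ i, m i ≠ 0 := by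
        by_contra! hcon
        have : m = 0 := Finsupp.ext hcon
        simp [this] at hm
      obtain ⟨m', rfl⟩ : ∃ m', m = m' + Finsupp.single i 1 :=
        ⟨m - Finsupp.single i 1, (tsub_add_cancel_of_le (by
          rw [Finsupp.single_le_iff]; omega)).symm⟩
      have h1 := ih m' (by simpa using hm) _ (hJ f hf i)
      rw [coeff_pderiv] at h1
      exact (mul_eq_zero.mp h1).resolve_right (Nat.cast_add_one_ne_zero _)
  ext m
  rw [coeff_zero]
  exact key _ m rfl f hf

variable {K : Type*} [Field K] {β : Type}

/-- The ring of polynomial functions on a set of points of affine space. -/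
abbrev CoordRing (C : Set (β → K)) : Type _ := MvPolynomial β K ⧸ vanishingIdeal K C

/-- The fields are derivations `D j` of the function field applied to the coordinates and multiplied
by a common denominator `s`, then lifted to polynomials. -/
theorem exists_tangent_fields [CharZero K] [Fintype β] {C : Set (β → K)}
    [hC : (vanishingIdeal K C).IsPrime] :
    ∃ τ : Fin (affDim C) → β → MvPolynomial β K,
      (∀ f ∈ vanishingIdeal K C, ∀ j, ∑ b, pderiv b f * τ j b ∈ vanishingIdeal K C) ∧
      LinearIndependent (FractionRing (CoordRing C)) fun j b =>
        algebraMap (CoordRing C) (FractionRing (CoordRing C)) (Ideal.Quotient.mk _ (τ j b)) := by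
  obtain ⟨D, y, hDy⟩ : ∃ (D : Fin (affDim C) → Derivation K (FractionRing (CoordRing C))
      (FractionRing (CoordRing C))) (y : Fin (affDim C) → CoordRing C),
      ∀ i j, D i (algebraMap (CoordRing C) _ (y j)) = if i = j then 1 else 0 :=
    exists_derivations K (CoordRing C)
  let x : β → FractionRing (CoordRing C) := fun b =>
    algebraMap (CoordRing C) _ (Ideal.Quotient.mk _ (X b))
  have hx : ∀ p : MvPolynomial β K,
      aeval x p = algebraMap (CoordRing C) (FractionRing (CoordRing C)) (Ideal.Quotient.mk _ p) :=
          by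
    intro p
    let ψ : MvPolynomial β K →ₐ[K] FractionRing (CoordRing C) :=
      (IsScalarTower.toAlgHom K (CoordRing C) _).comp (Ideal.Quotient.mkₐ K (vanishingIdeal K C))
    have : aeval x = ψ := by
      ext b
      rw [aeval_X]
      rfl
    rw [this]
    rfl
  obtain ⟨s, hs⟩ := IsLocalization.exist_integer_multiples_of_finite (nonZeroDivisors (CoordRing C))
    (fun jb : Fin (affDim C) × β => (D jb.1 (x jb.2) : FractionRing (CoordRing C)))
  choose a ha using hs
  choose q hq using fun a : CoordRing C => Ideal.Quotient.mk_surjective a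
  have hτ : ∀ j b, algebraMap (CoordRing C) (FractionRing (CoordRing C))
      (Ideal.Quotient.mk _ (q (a (j, b)))) =
        algebraMap (CoordRing C) (FractionRing (CoordRing C)) s * D j (x b) := by
    intro j b
    rw [hq, ha]
    exact Algebra.smul_def _ _
  have hs0 : algebraMap (CoordRing C) (FractionRing (CoordRing C)) s ≠ 0 :=
    IsFractionRing.to_map_ne_zero_of_mem_nonZeroDivisors s.2
  have hinj : Function.Injective (algebraMap (CoordRing C) (FractionRing (CoordRing C))) :=
    IsFractionRing.injective _ _
  refine ⟨fun j b => q (a (j, b)), ?_, ?_⟩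
  · intro f hf j
    have h1 := derivation_aeval (D j) x f
    rw [hx, Ideal.Quotient.eq_zero_iff_mem.mpr hf, map_zero, map_zero] at h1
    rw [← Ideal.Quotient.eq_zero_iff_mem]
    apply hinj
    rw [map_zero, map_sum, map_sum]
    simp only [map_mul, hτ]
    calc _ = algebraMap (CoordRing C) (FractionRing (CoordRing C)) s *
          ∑ b, aeval x (pderiv b f) • D j (x b) := by
          rw [Finset.mul_sum]
          refine Finset.sum_congr rfl fun b _ => ?_
          rw [hx, smul_eq_mul]
          ring
      _ = 0 := by rw [← h1, mul_zero]
  · rw [Fintype.linearIndependent_iff]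
    intro c hc i
    -- A combination of the derivations that kills the coordinates kills every regular function, in
    -- particular `y i`, where it takes the value `c i`.
    have hEx : ∀ b, ∑ j, c j * D j (x b) = 0 := by
      intro b
      have h1 := congrFun hc b
      simp only [Finset.sum_apply, Pi.smul_apply, smul_eq_mul, hτ, Pi.zero_apply] at h1
      refine (mul_eq_zero.mp ?_).resolve_left hs0
      rw [Finset.mul_sum, ← h1]
      refine Finset.sum_congr rfl fun j _ => ?_
      ring
    have h1 : ∑ j, c j * D j (aeval x (q (y i))) = 0 := by
      simp only [derivation_aeval, Finset.mul_sum]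
      rw [Finset.sum_comm]
      refine Finset.sum_eq_zero fun b _ => ?_
      calc _ = aeval x (pderiv b (q (y i))) * ∑ j, c j * D j (x b) := by
            rw [Finset.mul_sum]
            refine Finset.sum_congr rfl fun j _ => ?_
            rw [smul_eq_mul]
            ring
        _ = 0 := by rw [hEx, mul_zero]
    rw [hx, hq] at h1
    simp only [hDy] at h1
    simpa using h1

theorem exists_mem_span_sup_eq_top {L V : Type*} [Field L] [AddCommGroup V] [Module L V]
    [Module.Finite L V] {S : Set V} (hS : Submodule.span L S = ⊤) (W : Submodule L V) {k : ℕ}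
    (hk : Module.finrank L W + k = Module.finrank L V) :
    ∃ c : Fin k → V, (∀ l, c l ∈ S) ∧ W ⊔ Submodule.span L (Set.range c) = ⊤ := by
  have hQ : Module.finrank L (V ⧸ W) = k := by
    have := W.finrank_quotient_add_finrank
    omega
  have hspan : Submodule.span L (W.mkQ '' S) = ⊤ := by
    rw [Submodule.span_image, hS, Submodule.map_top, Submodule.range_mkQ]
  obtain ⟨f, hfS, hfspan, -⟩ := Submodule.exists_fun_fin_finrank_span_eq L (W.mkQ '' S)
  have hn : Module.finrank L (Submodule.span L (W.mkQ '' S)) = k := by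
    rw [hspan, finrank_top, hQ]
  choose c hc hcf using hfS
  refine ⟨c ∘ Fin.cast hn.symm, fun l => hc _, ?_⟩
  have himg : W.mkQ '' Set.range (c ∘ Fin.cast hn.symm) = Set.range f := by
    ext z
    simp only [Set.mem_image, Set.mem_range, Function.comp_apply, exists_exists_eq_and, hcf]
    exact ⟨fun ⟨l, hl⟩ => ⟨_, hl⟩, fun ⟨l, hl⟩ => ⟨Fin.cast hn l, hl⟩⟩
  rw [← Submodule.map_mkQ_eq_top, Submodule.map_span, himg, hfspan, hspan]

theorem span_image_algebraMap_eq_top {L : Type*} [Field L] [Algebra K L] [Fintype β]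
    {C : Set (β → K)} (hspan : Submodule.span K C = ⊤) :
    Submodule.span L ((fun (c : β → K) b => algebraMap K L (c b)) '' C) = ⊤ := by
  classical
  let inc : (β → K) →ₗ[K] (β → L) := (Algebra.linearMap K L).compLeft β
  change Submodule.span L (inc '' C) = ⊤
  rw [eq_top_iff]
  intro w _
  have h1 : ∀ u : β → K, inc u ∈ Submodule.span L (inc '' C) := by
    intro u
    have hu : u ∈ Submodule.span K C := hspan ▸ Submodule.mem_top
    have h2 : inc u ∈ Submodule.span K (inc '' C) := by
      rw [Submodule.span_image]
      exact Submodule.mem_map_of_mem hu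
    exact Submodule.span_le_restrictScalars K L _ h2
  rw [pi_eq_sum_univ' w]
  refine Submodule.sum_mem _ fun b _ => Submodule.smul_mem _ _ ?_
  convert! h1 (Pi.single b 1) using 1
  ext b'
  simp [inc, Pi.single_apply, apply_ite, eq_comm]

/-- Linear algebra at the generic point: the tangent fields span a space of dimension `affDim C`
over the function field, and constant vectors from `C` still span after extension of scalars, so `k`
of them complete a basis. The determinant is a nonzero function on `C`, hence nonzero at some `p`.
-/
theorem exists_tangent_complement [CharZero K] [Fintype β] [DecidableEq β] {C : Set (β → K)}
    (hC : (vanishingIdeal K C).IsPrime) (hspan : Submodule.span K C = ⊤) {k : ℕ}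
    (e : Fin (affDim C) ⊕ Fin k ≃ β) :
    ∃ (τ : Fin (affDim C) → β → MvPolynomial β K) (c : Fin k → β → K) (p : β → K),
      (∀ f ∈ vanishingIdeal K C, ∀ j, ∑ b, pderiv b f * τ j b ∈ vanishingIdeal K C) ∧
      (∀ l, c l ∈ C) ∧ p ∈ C ∧
      (Matrix.of fun a b => Sum.elim (fun j => eval p (τ j b)) (fun l => c l b) (e.symm a)).det ≠
        0 := by
  obtain ⟨τ, hτ, hind⟩ := exists_tangent_fields (C := C)
  let L := FractionRing (CoordRing C)
  let ψ : MvPolynomial β K →+* L := (algebraMap (CoordRing C) L).comp (Ideal.Quotient.mk _)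
  let v : Fin (affDim C) → β → L := fun j b => ψ (τ j b)
  have hcard : affDim C + k = Fintype.card β := by
    simpa using Fintype.card_congr e
  have hV : Module.finrank L (Submodule.span L (Set.range v)) = affDim C := by
    have := finrank_span_eq_card (b := v) hind
    simpa using this
  obtain ⟨c', hc', htop⟩ := exists_mem_span_sup_eq_top
    (span_image_algebraMap_eq_top (L := L) hspan) (Submodule.span L (Set.range v)) (k := k)
    (by rw [hV, Module.finrank_pi, hcard])
  choose c hcC hcc using hc'
  let N : Matrix β β (MvPolynomial β K) :=
    Matrix.of fun a b => Sum.elim (fun j => τ j b) (fun l => MvPolynomial.C (c l b)) (e.symm a)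
  have hrow : ∀ a, ψ.mapMatrix N a = Sum.elim v c' (e.symm a) := by
    intro a
    ext b
    rw [RingHom.mapMatrix_apply, Matrix.map_apply]
    simp only [N, Matrix.of_apply]
    rcases e.symm a with j | l
    · rfl
    · simp only [Sum.elim_inr, ← hcc]
      rfl
  have hli : LinearIndependent L (Sum.elim v c') := by
    refine linearIndependent_of_top_le_span_of_card_eq_finrank ?_ (by simpa using hcard)
    rw [Set.Sum.elim_range, Submodule.span_union, htop]
  have hunit : IsUnit (ψ.mapMatrix N) := by
    rw [← Matrix.linearIndependent_rows_iff_isUnit]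
    have : (ψ.mapMatrix N).row = Sum.elim v c' ∘ e.symm := funext hrow
    rw [this]
    exact hli.comp _ e.symm.injective
  have hdet : ψ N.det ≠ 0 := by
    rw [RingHom.map_det]
    exact ((Matrix.isUnit_iff_isUnit_det _).mp hunit).ne_zero
  have hnot : N.det ∉ vanishingIdeal K C := by
    intro h
    refine hdet ?_
    change algebraMap (CoordRing C) L (Ideal.Quotient.mk _ N.det) = 0
    rw [Ideal.Quotient.eq_zero_iff_mem.mpr h, map_zero]
  rw [mem_vanishingIdeal] at hnot
  push Not at hnot
  obtain ⟨p, hp, hpN⟩ := hnot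
  refine ⟨τ, c, p, hτ, hcC, hp, ?_⟩
  rw [RingHom.map_det] at hpN
  convert! hpN using 2
  ext a b
  rw [RingHom.mapMatrix_apply, Matrix.map_apply]
  simp only [N, Matrix.of_apply]
  rcases e.symm a with j | l <;> simp

end TangentFields

/-! ### Density of sums of decomposable tensors -/

section DecomposableTensors

variable {K : Type*} [Field K] {ι β : Type}

theorem exists_forall_ne_zero {C : Set (ι → K)} (hC : (vanishingIdeal K C).IsPrime) {α : Type*}
    {f : α → (ι → K) → K} (hf : ∀ a, IsPolyFun (f a)) (h : ∀ a, ∃ x ∈ C, f a x ≠ 0)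
    (s : Finset α) : ∃ x ∈ C, ∏ a ∈ s, f a x ≠ 0 := by
  classical
  rw [isPrime_vanishingIdeal_iff] at hC
  induction s using Finset.induction_on with
  | empty =>
    obtain ⟨x, hx⟩ := hC.1
    exact ⟨x, hx, by simp⟩
  | insert a s ha ih =>
    obtain ⟨x, hx, h1, h2⟩ := hC.2 _ _ (hf a) (.prod hf) (h a) ih
    exact ⟨x, hx, by rw [Finset.prod_insert ha]; exact mul_ne_zero h1 h2⟩

/-- The matrix `∑ i, uᵢ ⊗ xᵢ`. -/
def tensorSum {m : ℕ} {α : Type} (u : Fin m → α → K) (x : Fin m → β → K) : α × β → K :=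
  fun ab => ∑ i, u i ab.1 * x i ab.2

theorem tensorSum_update_left {m : ℕ} {α : Type} (u : Fin m → α → K) (x : Fin m → β → K) (i : Fin m)
    (w : α → K) (ab : α × β) : tensorSum (Function.update u i w) x ab =
      tensorSum u x ab + (w ab.1 - u i ab.1) * x i ab.2 := by
  rw [← sub_eq_iff_eq_add', tensorSum, tensorSum, ← Finset.sum_sub_distrib,
    Finset.sum_eq_single i]
  · rw [Function.update_self]
    ring
  · intro i' _ h
    rw [Function.update_of_ne h, sub_self]
  · exact fun h => absurd (Finset.mem_univ i) h

theorem tensorSum_update_right {m : ℕ} {α : Type} (u : Fin m → α → K) (x : Fin m → β → K)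
    (i : Fin m) (y : β → K) (ab : α × β) : tensorSum u (Function.update x i y) ab =
      tensorSum u x ab + u i ab.1 * (y ab.2 - x i ab.2) := by
  rw [← sub_eq_iff_eq_add', tensorSum, tensorSum, ← Finset.sum_sub_distrib,
    Finset.sum_eq_single i]
  · rw [Function.update_self]
    ring
  · intro i' _ h
    rw [Function.update_of_ne h, sub_self]
  · exact fun h => absurd (Finset.mem_univ i) h

/-- Derivative of `F` at `t = 0` along the line obtained by replacing `u i` with `u i + t e_a`; the
line stays inside the sums. -/
theorem sum_pderiv_tensorSum_left [Infinite K] [Fintype β] {m : ℕ} {α : Type} [Fintype α] {C : Set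
    (β → K)}
    {F : MvPolynomial (α × β) K}
    (hF : ∀ (u : Fin m → α → K) (x : Fin m → β → K), (∀ i, x i ∈ C) → eval (tensorSum u x) F = 0)
    (u : Fin m → α → K) {x : Fin m → β → K} (hx : ∀ i, x i ∈ C) (i : Fin m) (a : α) :
    ∑ b, eval (tensorSum u x) (pderiv (a, b) F) * x i b = 0 := by
  classical
  let ψ : α × β → Polynomial K := fun ab =>
    Polynomial.C (tensorSum u x ab) + Polynomial.C (if ab.1 = a then x i ab.2 else 0) * Polynomial.X
  have hψ : ∀ (p : MvPolynomial (α × β) K) (t : K),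
      (aeval ψ p).eval t = eval (fun ab => (ψ ab).eval t) p := by
    intro p t
    have : (Polynomial.aeval t).comp (aeval ψ) = aeval fun ab => (ψ ab).eval t := by
      ext ab
      simp [Polynomial.aeval_def]
    have := DFunLike.congr_fun this p
    rwa [AlgHom.comp_apply, aeval_eq_eval, Polynomial.coe_aeval_eq_eval] at this
  have h0 : aeval ψ F = 0 := by
    apply Polynomial.funext
    intro t
    rw [hψ, Polynomial.eval_zero, ← hF (Function.update u i (u i + t • Pi.single a 1)) x hx]
    congr 2
    ext ab
    rw [tensorSum_update_left]
    simp [ψ, Pi.single_apply]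
    split_ifs <;> ring
  have h1 := derivation_aeval Polynomial.derivative' ψ F
  rw [h0, map_zero] at h1
  have h2 := congrArg (Polynomial.eval 0) h1.symm
  simp only [Polynomial.eval_finsetSum, smul_eq_mul, Polynomial.eval_mul, hψ] at h2
  simpa [ψ, Polynomial.derivative', Fintype.sum_prod_type, Finset.sum_ite_eq] using h2

/-- With all other data fixed, `F` becomes a polynomial in the `i`-th vector alone that vanishes on
`C`; the tangent field `τ` preserves such vanishing, and the chain rule does the rest. -/
theorem sum_pderiv_tensorSum_right [Fintype β] {m : ℕ} {α : Type} [Fintype α] {C : Set (β → K)}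
    {F : MvPolynomial (α × β) K}
    (hF : ∀ (u : Fin m → α → K) (x : Fin m → β → K), (∀ i, x i ∈ C) → eval (tensorSum u x) F = 0)
    (u : Fin m → α → K) {x : Fin m → β → K} (hx : ∀ i, x i ∈ C) (i : Fin m)
    {τ : β → MvPolynomial β K}
    (hτ : ∀ f ∈ vanishingIdeal K C, ∑ b, pderiv b f * τ b ∈ vanishingIdeal K C) :
    ∑ b, eval (x i) (τ b) * ∑ a, u i a * eval (tensorSum u x) (pderiv (a, b) F) = 0 := by
  classical
  let ψ : α × β → MvPolynomial β K := fun ab =>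
    MvPolynomial.C (tensorSum u x ab - u i ab.1 * x i ab.2) + MvPolynomial.C (u i ab.1) * X ab.2
  have hψ : ∀ (p : MvPolynomial (α × β) K) (y : β → K),
      eval y (aeval ψ p) = eval (fun ab => eval y (ψ ab)) p := by
    intro p y
    have : (aeval y).comp (aeval ψ) = aeval fun ab => eval y (ψ ab) := by
      ext ab
      simp [aeval_eq_eval]
    have := DFunLike.congr_fun this p
    rwa [AlgHom.comp_apply, aeval_eq_eval, aeval_eq_eval] at this
  have h0 : aeval ψ F ∈ vanishingIdeal K C := by
    rw [mem_vanishingIdeal]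
    intro y hy
    rw [hψ, ← hF u (Function.update x i y) (fun i' => by
      by_cases h : i' = i
      · subst h; simpa using hy
      · rw [Function.update_of_ne h]; exact hx i')]
    congr 2
    ext ab
    rw [tensorSum_update_right]
    simp [ψ]
    ring
  have h1 := mem_vanishingIdeal.mp (hτ _ h0) (x i) (hx i)
  have h2 : (fun ab => eval (x i) (ψ ab)) = tensorSum u x := by
    ext ab
    simp [ψ]
  simp only [map_sum, map_mul, derivation_aeval, hψ, h2, smul_eq_mul] at h1
  rw [← h1]
  refine Finset.sum_congr rfl fun b _ => ?_
  rw [mul_comm]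
  congr 1
  rw [Fintype.sum_prod_type]
  refine Finset.sum_congr rfl fun a _ => ?_
  rw [Finset.sum_eq_single b]
  · simp [ψ, mul_comm]
  · intro b' _ hb'
    simp [ψ, pderiv_X_of_ne hb']
  · exact fun h => absurd (Finset.mem_univ b) h

/-- The matrix whose rows are the values at `x i` of the vector fields `τ` and the other `x j`. -/
def tangentMatrix {d k : ℕ} (e : Fin d ⊕ Fin k ≃ β) (τ : Fin d → β → MvPolynomial β K)
    (i : Fin (k + 1)) (x : Fin (k + 1) → β → K) : Matrix β β K :=
  Matrix.of fun a b =>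
    Sum.elim (fun j => eval (x i) (τ j b)) (fun l => x (i.succAbove l) b) (e.symm a)

theorem isPolyFun_tangentMatrix {d k : ℕ} (e : Fin d ⊕ Fin k ≃ β)
    (τ : Fin d → β → MvPolynomial β K) (i : Fin (k + 1)) {φ : (ι → K) → Fin (k + 1) → β → K}
    (hφ : ∀ i b, IsPolyFun fun z => φ z i b) (a b : β) :
    IsPolyFun fun z => tangentMatrix e τ i (φ z) a b := by
  simp only [tangentMatrix, Matrix.of_apply]
  rcases e.symm a with j | l
  · exact IsPolyFun.comp (φ := fun z => φ z i) (F := fun y => eval y (τ j b)) (hφ i)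
      (.eval_poly (τ j b))
  · exact hφ _ b

/-- The Terracini step: `tangentMatrix` annihilates the gradient contracted with `u i`, so each
contraction is zero, and invertibility of `u` removes the contraction. -/
theorem pderiv_eq_zero_of_det_ne_zero [Infinite K] [Fintype β] [DecidableEq β] {C : Set (β → K)}
    {d k : ℕ} (e : Fin d ⊕ Fin k ≃ β) {τ : Fin d → β → MvPolynomial β K}
    (hτ : ∀ f ∈ vanishingIdeal K C, ∀ j, ∑ b, pderiv b f * τ j b ∈ vanishingIdeal K C)
    {F : MvPolynomial (Fin (k + 1) × β) K}
    (hF : ∀ (u : Fin (k + 1) → Fin (k + 1) → K) (x : Fin (k + 1) → β → K), (∀ i, x i ∈ C) →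
      eval (tensorSum u x) F = 0) {u : Fin (k + 1) → Fin (k + 1) → K} {x : Fin (k + 1) → β → K}
    (hx : ∀ i, x i ∈ C) (hu : (Matrix.of u).det ≠ 0)
    (hG : ∀ i, (tangentMatrix e τ i x).det ≠ 0) (a : Fin (k + 1)) (b : β) :
    eval (tensorSum u x) (pderiv (a, b) F) = 0 := by
  have h1 : ∀ i b, ∑ a, u i a * eval (tensorSum u x) (pderiv (a, b) F) = 0 := by
    intro i b
    refine congrFun (Matrix.eq_zero_of_mulVec_eq_zero (hG i)
      (v := fun b => ∑ a, u i a * eval (tensorSum u x) (pderiv (a, b) F)) ?_) b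
    ext b'
    change ∑ b, tangentMatrix e τ i x b' b * _ = 0
    simp only [tangentMatrix, Matrix.of_apply]
    rcases e.symm b' with j | l
    · exact sum_pderiv_tensorSum_right hF u hx i (fun f hf => hτ f hf j)
    · simp only [Sum.elim_inr, Finset.mul_sum]
      rw [Finset.sum_comm]
      refine Finset.sum_eq_zero fun a _ => ?_
      have := sum_pderiv_tensorSum_left hF u hx (i.succAbove l) a
      calc _ = u i a * ∑ b, eval (tensorSum u x) (pderiv (a, b) F) * x (i.succAbove l) b := by
            rw [Finset.mul_sum]
            exact Finset.sum_congr rfl fun b _ => by ring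
        _ = 0 := by rw [this, mul_zero]
  exact congrFun (Matrix.eq_zero_of_mulVec_eq_zero hu
    (v := fun a => eval (tensorSum u x) (pderiv (a, b) F)) (funext fun i => h1 i b)) a

/-- Sums of `k + 1` decomposable tensors with second factors in `C` are dense when `k` is the
codimension of `C`. -/
theorem eq_zero_of_forall_tensorSum [CharZero K] [Fintype β] {C : Set (β → K)}
    (hC : (vanishingIdeal K C).IsPrime) (hspan : Submodule.span K C = ⊤) {k : ℕ}
    (hk : affDim C + k = Fintype.card β) {F : MvPolynomial (Fin (k + 1) × β) K}
    (hF : ∀ (u : Fin (k + 1) → Fin (k + 1) → K) (x : Fin (k + 1) → β → K), (∀ i, x i ∈ C) →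
      eval (tensorSum u x) F = 0) : F = 0 := by
  classical
  let e : Fin (affDim C) ⊕ Fin k ≃ β := Fintype.equivOfCardEq (by simpa using hk)
  obtain ⟨τ, c, p, hτ, hc, hp, hdet⟩ := exists_tangent_complement hC hspan e
  obtain ⟨x₀, hx₀⟩ := (isPrime_vanishingIdeal_iff.mp hC).1
  refine eq_zero_of_pderiv_stable (J := {F | ∀ (u : Fin (k + 1) → Fin (k + 1) → K)
    (x : Fin (k + 1) → β → K), (∀ i, x i ∈ C) → eval (tensorSum u x) F = 0}) ?_ ?_ hF
  · intro F hF
    convert hF 0 (fun _ => x₀) (fun _ => hx₀)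
    ext ab
    simp [tensorSum]
  · rintro F hF ⟨a, b⟩ u x hx
    by_contra hne
    -- The irreducible parameter space of all pairs `(u, x)`, where the finitely many open
    -- conditions can be imposed at once.
    let T : Set ((Fin (k + 1) × Fin (k + 1)) ⊕ (Fin (k + 1) × β) → K) :=
      prodSet Set.univ (powSet (k + 1) C)
    let U : ((Fin (k + 1) × Fin (k + 1)) ⊕ (Fin (k + 1) × β) → K) → Fin (k + 1) → Fin (k + 1) → K :=
      fun z i a => z (.inl (i, a))
    let V : ((Fin (k + 1) × Fin (k + 1)) ⊕ (Fin (k + 1) × β) → K) → Fin (k + 1) → β → K :=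
      fun z i b => z (.inr (i, b))
    have hU : ∀ i a, IsPolyFun fun z => U z i a := fun i a => .coord (Sum.inl (i, a))
    have hV : ∀ i b, IsPolyFun fun z => V z i b := fun i b => .coord (Sum.inr (i, b))
    have hT : (vanishingIdeal K T).IsPrime := isPrime_prodSet isPrime_univ (isPrime_powSet _ hC)
    have hmk : ∀ (u : Fin (k + 1) → Fin (k + 1) → K) (x : Fin (k + 1) → β → K),
        (∀ i, x i ∈ C) → ∃ z ∈ T, U z = u ∧ V z = x :=
      fun u x hx => ⟨Sum.elim (fun ia => u ia.1 ia.2) (fun ib => x ib.1 ib.2),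
        ⟨Set.mem_univ _, hx⟩, rfl, rfl⟩
    have hpoly₁ : ∀ i, IsPolyFun fun z => (tangentMatrix e τ i (V z)).det := fun i =>
      IsPolyFun.det (isPolyFun_tangentMatrix e τ i hV)
    have hpoly₂ : IsPolyFun fun z => (Matrix.of (U z)).det := IsPolyFun.det hU
    have hpoly₃ : IsPolyFun fun z => eval (tensorSum (U z) (V z)) (pderiv (a, b) F) :=
      IsPolyFun.comp (φ := fun z => tensorSum (U z) (V z))
        (F := fun y => eval y (pderiv (a, b) F))
        (fun ab => IsPolyFun.sum fun i => (hU i ab.1).mul (hV i ab.2)) (.eval_poly _)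
    -- For each `i` separately, the tuple with `p` in place `i` and the points `c` elsewhere makes
    -- the `i`-th determinant nonzero; irreducibility provides one tuple for all `i`.
    obtain ⟨z₁, hz₁, h1⟩ := exists_forall_ne_zero hT hpoly₁ (fun i => by
      obtain ⟨z, hz, -, hzV⟩ := hmk 0 (i.insertNth p c)
        (fun i' => Fin.succAboveCases i (by simpa using hp) (by simpa using hc) i')
      refine ⟨z, hz, ?_⟩
      rw [hzV]
      simpa [tangentMatrix] using hdet) Finset.univ
    obtain ⟨z₂, hz₂, hzU, -⟩ := hmk (fun i a => (1 : Matrix (Fin (k + 1)) (Fin (k + 1)) K) i a) x hx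
    obtain ⟨z₃, hz₃, hzU₃, hzV₃⟩ := hmk u x hx
    have hcrit := (isPrime_vanishingIdeal_iff.mp hT).2
    obtain ⟨z₄, hz₄, h4, h4'⟩ := hcrit _ _ hpoly₂ hpoly₃
      ⟨z₂, hz₂, by
        rw [hzU]
        change (1 : Matrix (Fin (k + 1)) (Fin (k + 1)) K).det ≠ 0
        simp⟩
      ⟨z₃, hz₃, by rwa [hzU₃, hzV₃]⟩
    obtain ⟨z, hz, h5, h6⟩ := hcrit _ _ (IsPolyFun.prod hpoly₁) (hpoly₂.mul hpoly₃) ⟨z₁, hz₁, h1⟩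
      ⟨z₄, hz₄, mul_ne_zero h4 h4'⟩
    rw [Finset.prod_ne_zero_iff] at h5
    exact (mul_ne_zero_iff.mp h6).2 (pderiv_eq_zero_of_det_ne_zero e hτ hF hz.2
      (mul_ne_zero_iff.mp h6).1 (fun i => h5 i (Finset.mem_univ i)) a b)

end DecomposableTensors

/-! ### Secant varieties as sums of cones, and the numerical criterion -/

section SecantVarieties

variable {K : Type*} [Field K] {ι : Type}

theorem submodule_span_eq (S : Set (ℙ K (ι → K))) :
    Projectivization.Subspace.submodule (Projectivization.Subspace.span S) =
      Submodule.span K (Projectivization.rep '' S) := by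
  apply le_antisymm
  · rw [← OrderIso.le_symm_apply, Projectivization.Subspace.span_le_subspace_iff]
    intro p hp
    have h := (Projectivization.Subspace.mem_submodule_iff (K := K)
      (Projectivization.Subspace.submodule.symm (Submodule.span K (Projectivization.rep '' S)))
      p.rep_nonzero).mp (by
        rw [OrderIso.apply_symm_apply]
        exact Submodule.subset_span ⟨p, hp, rfl⟩)
    rwa [Projectivization.mk_rep] at h
  · rw [Submodule.span_le]
    rintro _ ⟨p, hp, rfl⟩
    refine (Projectivization.Subspace.mem_submodule_iff _ p.rep_nonzero).mpr ?_
    rw [Projectivization.mk_rep]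
    exact Projectivization.Subspace.subset_span _ hp

theorem mk_mem_span_iff {S : Set (ℙ K (ι → K))} {v : ι → K} (hv : v ≠ 0) :
    Projectivization.mk K v hv ∈ Projectivization.Subspace.span S ↔
      v ∈ Submodule.span K (Projectivization.rep '' S) := by
  rw [← submodule_span_eq, Projectivization.Subspace.mem_submodule_iff _ hv]

/-- The set of all sums of `s` elements of a set. -/
def sumSet (s : ℕ) (C : Set (ι → K)) : Set (ι → K) :=
  {z | ∃ c : Fin s → ι → K, (∀ i, c i ∈ C) ∧ ∑ i, c i = z}

theorem sumSet_one (C : Set (ι → K)) : sumSet 1 C = C := by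
  ext z
  constructor
  · rintro ⟨c, hc, rfl⟩
    simpa using hc 0
  · intro hz
    exact ⟨fun _ => z, fun _ => hz, by simp⟩

theorem sumSet_succ (s : ℕ) (C : Set (ι → K)) :
    sumSet (s + 1) C = (fun (z : ι ⊕ ι → K) i => z (.inl i) + z (.inr i)) ''
      prodSet (sumSet s C) C := by
  ext z
  constructor
  · rintro ⟨c, hc, rfl⟩
    refine ⟨Sum.elim (∑ i : Fin s, c i.castSucc) (c (Fin.last s)),
      elim_mem_prodSet ⟨_, fun i => hc _, rfl⟩ (hc _), ?_⟩
    rw [Fin.sum_univ_castSucc]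
    rfl
  · rintro ⟨w, ⟨⟨c, hc, hcw⟩, hw⟩, rfl⟩
    refine ⟨Fin.snoc (α := fun _ => ι → K) c (fun i => w (.inr i)), fun i => ?_, ?_⟩
    · refine Fin.lastCases ?_ (fun i => ?_) i
      · simpa using hw
      · simpa using hc i
    · rw [Fin.sum_univ_castSucc]
      simp only [Fin.snoc_castSucc, Fin.snoc_last, hcw]
      rfl

theorem isPrime_sumSet (s : ℕ) {C : Set (ι → K)} (hC : (vanishingIdeal K C).IsPrime) :
    (vanishingIdeal K (sumSet s C)).IsPrime := by
  induction s with
  | zero =>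
    have : sumSet 0 C = {0} := by
      ext z
      simp [sumSet, eq_comm]
    rw [this]
    exact isPrime_vanishingIdeal_singleton _
  | succ s ih =>
    rw [sumSet_succ]
    exact isPrime_image (fun i => (IsPolyFun.coord (Sum.inl i)).add (.coord (Sum.inr i)))
      (isPrime_prodSet ih hC)

/-- Read backwards, this bounds the dimension for `s` summands from below by the dimension for more
summands. -/
theorem affDim_sumSet_add_le [Finite ι] (s j : ℕ) {C : Set (ι → K)}
    (hC : (vanishingIdeal K C).IsPrime) :
    affDim (sumSet (s + j) C) ≤ affDim (sumSet s C) + j * affDim C := by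
  induction j with
  | zero => simp
  | succ j ih =>
    rw [← add_assoc, sumSet_succ]
    refine (affDim_image_le
      (fun i => (IsPolyFun.coord (Sum.inl i)).add (.coord (Sum.inr i))) _).trans ?_
    refine (affDim_prodSet_le (isPrime_sumSet _ hC) hC).trans ?_
    rw [add_mul, one_mul]
    omega

theorem sumSet_subset_of_le {C : Set (ι → K)} (h0 : (0 : ι → K) ∈ C) {s t : ℕ} (h : s ≤ t) :
    sumSet s C ⊆ sumSet t C := by
  induction h with
  | refl => rfl
  | step _ ih =>
    refine ih.trans fun z hz => ?_
    rw [sumSet_succ]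
    exact ⟨Sum.elim z 0, elim_mem_prodSet hz h0, by ext; simp⟩

theorem cone_iUnion_span {s : ℕ} {Y : Set (ℙ K (ι → K))} (hY : Y.Nonempty) :
    cone (⋃ (P : Fin s → ℙ K (ι → K)) (_ : ∀ i, P i ∈ Y),
      (Projectivization.Subspace.span (Set.range P) : Set (ℙ K (ι → K)))) = sumSet s (cone Y) := by
  obtain ⟨q, hq⟩ := hY
  ext v
  constructor
  · intro hv
    rcases eq_or_ne v 0 with rfl | h0
    · exact ⟨fun _ => 0, fun _ => zero_mem_cone Y, by simp⟩
    · have := hv h0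
      simp only [Set.mem_iUnion] at this
      obtain ⟨P, hP, hvP⟩ := this
      rw [SetLike.mem_coe, mk_mem_span_iff h0, ← Set.range_comp,
        Submodule.mem_span_range_iff_exists_fun] at hvP
      obtain ⟨a, ha⟩ := hvP
      exact ⟨_, fun i => smul_mem_cone (rep_mem_cone.mpr (hP i)) (a i), ha⟩
  · rintro ⟨c, hc, rfl⟩ h0
    classical
    simp only [Set.mem_iUnion]
    -- A zero summand determines no point; any `q` of `Y` can fill its place.
    refine ⟨fun i => if h : c i ≠ 0 then Projectivization.mk K (c i) h else q, fun i => ?_, ?_⟩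
    · dsimp only
      split_ifs with h
      · exact hc i h
      · exact hq
    · rw [SetLike.mem_coe, mk_mem_span_iff h0, ← submodule_span_eq]
      refine Submodule.sum_mem _ fun i _ h => ?_
      refine Projectivization.Subspace.subset_span _ ⟨i, ?_⟩
      simp [h]

theorem eval_eq_zero_of_mem_cone {W : Set (ℙ K (ι → K))} (hW : W.Nonempty) {f : MvPolynomial ι K}
    {d : ℕ} (hf : f.IsHomogeneous d) (h : ∀ p ∈ W, eval p.rep f = 0) {v : ι → K}
    (hv : v ∈ cone W) : eval v f = 0 := by
  rcases eq_or_ne v 0 with rfl | h0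
  · obtain ⟨p, hp⟩ := hW
    rw [← zero_smul K p.rep, eval_smul_of_isHomogeneous hf, h p hp, mul_zero]
  · rw [← eval_rep_mk hf h0]
    exact h _ (hv h0)

theorem isIrreducible_of_isPrime_cone {W : Set (ℙ K (ι → K))} (hW : W.Nonempty)
    (h : (vanishingIdeal K (cone W)).IsPrime) : IsIrreducible W := by
  refine isIrreducible_of_forall_homogeneous hW fun f g a b hf hg hfg => ?_
  have key : f * g ∈ vanishingIdeal K (cone W) := by
    rw [mem_vanishingIdeal]
    exact fun v hv => eval_eq_zero_of_mem_cone hW (hf.mul hg) (by simpa using hfg) hv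
  exact (h.mem_or_mem key).imp
    (fun h p hp => mem_vanishingIdeal.mp h _ (rep_mem_cone.mpr hp))
    (fun h p hp => mem_vanishingIdeal.mp h _ (rep_mem_cone.mpr hp))

/-- The dimension of a secant variety is read off from sums of points of the cone. -/
theorem dim_secantVariety_add_one [IsAlgClosed K] [Finite ι] {s : ℕ} (hs : 1 ≤ s)
    {Y : Set (ℙ K (ι → K))} (hY : IsIrreducible Y) :
    dim (secantVariety s Y) + 1 = (affDim (sumSet s (cone Y)) : ℕ) := by
  have : Infinite K := IsAlgClosed.instInfinite
  have hcone := cone_iUnion_span (s := s) hY.nonempty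
  have hprime := isPrime_sumSet s (isPrime_cone_of_isIrreducible hY)
  have hne : (⋃ (P : Fin s → ℙ K (ι → K)) (_ : ∀ i, P i ∈ Y),
      (Projectivization.Subspace.span (Set.range P) : Set (ℙ K (ι → K)))).Nonempty := by
    obtain ⟨q, hq⟩ := hY.nonempty
    refine ⟨q, Set.mem_iUnion₂.mpr ⟨fun _ => q, fun _ => hq, ?_⟩⟩
    exact Projectivization.Subspace.subset_span _ ⟨⟨0, hs⟩, rfl⟩
  have hirr := isIrreducible_of_isPrime_cone hne (by rwa [hcone])
  rw [secantVariety, dim_add_one_of_isClosed hirr.closure isClosed_closure,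
    affDim_congr (vanishingIdeal_cone_closure hne), hcone]

/-- Removing the zeros of a polynomial function does not change the closure of a parametrized set.
-/
theorem vanishingIdeal_image_ne_zero {κ : Type} {φ : (κ → K) → ι → K}
    (hφ : ∀ i, IsPolyFun fun x => φ x i) {C : Set (κ → K)} (hC : (vanishingIdeal K C).IsPrime)
    {g : (κ → K) → K} (hg : IsPolyFun g) (hne : ∃ x ∈ C, g x ≠ 0) :
    vanishingIdeal K (φ '' {x ∈ C | g x ≠ 0}) = vanishingIdeal K (φ '' C) := by
  refine le_antisymm (fun f hf => ?_)
    (vanishingIdeal_anti_mono (Set.image_mono (Set.sep_subset _ _)))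
  rw [mem_vanishingIdeal, Set.forall_mem_image] at hf ⊢
  intro x hx
  by_contra hcon
  obtain ⟨y, hy, h1, h2⟩ := (isPrime_vanishingIdeal_iff.mp hC).2 g (fun x => eval (φ x) f) hg
    (IsPolyFun.comp (F := fun y => eval y f) hφ (.eval_poly f)) hne ⟨x, hx, hcon⟩
  exact h2 (hf ⟨hy, h1⟩)

/-- The tensor product of a vector of `K ^ (k + 1)` with a vector of the second factor. -/
def tensor {κ β : Type} (E : κ × β ≃ ι) (u : κ → K) (v : β → K) : ι → K :=
  fun i => u (E.symm i).1 * v (E.symm i).2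

theorem tensor_smul {κ β : Type} (E : κ × β ≃ ι) (t : K) (u : κ → K) (v : β → K) :
    tensor E u (t • v) = tensor E (t • u) v := by
  ext i
  simp only [tensor, Pi.smul_apply, smul_eq_mul]
  ring

/-- The set of the tensor products of arbitrary vectors with the elements of a set. -/
def tensorSet {κ β : Type} (E : κ × β ≃ ι) (C : Set (β → K)) : Set (ι → K) :=
  {z | ∃ u, ∃ v ∈ C, tensor E u v = z}

theorem isPolyFun_tensor {κ β : Type} (E : κ × β ≃ ι) (i : ι) :
    IsPolyFun fun z : κ ⊕ β → K => tensor E (fun a => z (.inl a)) (fun b => z (.inr b)) i :=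
  (IsPolyFun.coord (Sum.inl _)).mul (.coord (Sum.inr _))

theorem tensorSet_eq_image {κ β : Type} (E : κ × β ≃ ι) (C : Set (β → K)) :
    tensorSet E C = (fun z : κ ⊕ β → K => tensor E (fun a => z (.inl a)) (fun b => z (.inr b))) ''
      prodSet Set.univ C := by
  ext z
  constructor
  · rintro ⟨u, v, hv, rfl⟩
    exact ⟨Sum.elim u v, elim_mem_prodSet (Set.mem_univ _) hv, rfl⟩
  · rintro ⟨w, ⟨-, hw⟩, rfl⟩
    exact ⟨_, _, hw, rfl⟩

theorem isPrime_tensorSet [Infinite K] {κ β : Type} (E : κ × β ≃ ι) {C : Set (β → K)}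
    (hC : (vanishingIdeal K C).IsPrime) : (vanishingIdeal K (tensorSet E C)).IsPrime := by
  rw [tensorSet_eq_image]
  exact isPrime_image (isPolyFun_tensor E) (isPrime_prodSet isPrime_univ hC)

/-- On the dense set where the first coordinate of `u` is nonzero, that coordinate can be moved into
`v`, as `C` is stable under scaling. Normalizing it to `1` leaves `k` parameters for `u`. -/
theorem affDim_tensorSet_le [Infinite K] [Finite ι] {β : Type} [Finite β] {k : ℕ}
    (E : Fin (k + 1) × β ≃ ι) {C : Set (β → K)} (hC : (vanishingIdeal K C).IsPrime)
    (hsmul : ∀ v ∈ C, ∀ t : K, t • v ∈ C) : affDim (tensorSet E C) ≤ k + affDim C := by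
  let U : (Fin k ⊕ β → K) → Fin (k + 1) → K := fun z => Fin.cons 1 fun i => z (.inl i)
  have hU : ∀ a, IsPolyFun fun z => U z a := fun a =>
    Fin.cases (.const 1) (fun i => .coord (Sum.inl i)) a
  have hφ : ∀ i, IsPolyFun fun z => tensor E (U z) (fun b => z (.inr b)) i :=
    fun i => (hU _).mul (.coord (Sum.inr _))
  obtain ⟨x, hx⟩ := (isPrime_vanishingIdeal_iff.mp hC).1
  rw [tensorSet_eq_image, ← affDim_congr (vanishingIdeal_image_ne_zero (isPolyFun_tensor E)
    (isPrime_prodSet isPrime_univ hC) (g := fun z => z (.inl 0)) (.coord _)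
    ⟨_, elim_mem_prodSet (Set.mem_univ 1) hx, by simp⟩)]
  have hI := (affDim_image_le hφ (prodSet Set.univ C)).trans (affDim_prodSet_le isPrime_univ hC)
  rw [affDim_univ, Nat.card_fin] at hI
  refine (affDim_mono ?_).trans hI
  rintro _ ⟨z, ⟨⟨-, hz⟩, hz0⟩, rfl⟩
  refine ⟨Sum.elim (fun i => (z (.inl 0))⁻¹ * z (.inl i.succ)) (z (.inl 0) • fun b => z (.inr b)),
    ⟨Set.mem_univ _, hsmul _ hz _⟩, ?_⟩
  change tensor E (Fin.cons 1 fun i => (z (.inl 0))⁻¹ * z (.inl (Fin.succ i)))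
    (z (.inl 0) • fun b => z (.inr b)) = _
  rw [tensor_smul]
  congr 1
  ext a
  refine Fin.cases ?_ (fun i => ?_) a <;> simp [hz0]

/-- A variety whose cone consists of the decomposable tensors with second factor in the cone `C`
is never defective when the first factor has the dimension of a complement of `C`. -/
theorem not_isDefective_of_tensor [IsAlgClosed K] [CharZero K] [Fintype ι] {β : Type} [Fintype β]
    {k : ℕ} (E : Fin (k + 1) × β ≃ ι) {C : Set (β → K)} (hC : (vanishingIdeal K C).IsPrime)
    (hsmul : ∀ v ∈ C, ∀ t : K, t • v ∈ C) (hspan : Submodule.span K C = ⊤)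
    (hk : affDim C + k = Fintype.card β) {Y : Set (ℙ K (ι → K))} (hY : IsIrreducible Y)
    (hdim : dim Y + 1 = (affDim (cone Y) : ℕ))
    (hcone : cone Y = tensorSet E C) {s : ℕ} (hs : 1 ≤ s) :
    ¬ IsDefective s Y := by
  have : Infinite K := IsAlgClosed.instInfinite
  have hprime := isPrime_cone_of_isIrreducible hY
  have hcard : Fintype.card ι = (k + 1) * Fintype.card β := by
    rw [← Fintype.card_congr E, Fintype.card_prod, Fintype.card_fin]
  have hfull : affDim (sumSet (k + 1) (cone Y)) = Fintype.card ι := by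
    rw [← Nat.card_eq_fintype_card, ← affDim_univ (K := K)]
    refine affDim_congr ?_
    rw [vanishingIdeal_univ, eq_bot_iff]
    intro F hF
    rw [mem_vanishingIdeal] at hF
    refine rename_injective _ E.symm.injective ?_
    rw [map_zero]
    refine eq_zero_of_forall_tensorSum hC hspan hk fun u x hx => ?_
    rw [eval_rename]
    refine hF _ ⟨fun i => tensor E (u i) (x i), fun i => ?_, ?_⟩
    · rw [hcone]
      exact ⟨_, _, hx i, rfl⟩
    · ext j
      simp [tensorSum, tensor, Finset.sum_apply]
  have hle : affDim (cone Y) ≤ Fintype.card β := by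
    rw [← hk, add_comm]
    exact hcone ▸ affDim_tensorSet_le E hC hsmul
  -- Filling forces `(k + 1) * card β ≤ (k + 1) * affDim (cone Y)`, the converse of `hle`.
  have hDeq : affDim (cone Y) = Fintype.card β := by
    have h1 := affDim_sumSet_add_le 1 k hprime
    rw [add_comm 1 k, hfull, sumSet_one, hcard] at h1
    nlinarith
  have hkey : affDim (sumSet s (cone Y)) = min (s * Fintype.card β) (Fintype.card ι) := by
    apply le_antisymm
    · refine le_min ?_ ?_
      · obtain ⟨j, rfl⟩ := Nat.exists_eq_add_of_le hs
        have h1 := affDim_sumSet_add_le 1 j hprime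
        rw [sumSet_one, hDeq] at h1
        linarith
      · rw [← Nat.card_eq_fintype_card, ← affDim_univ (K := K)]
        exact affDim_mono (Set.subset_univ _)
    -- Below `k + 1`, the missing `k + 1 - s` summands contribute at most `card β` each to a
    -- full-dimensional set; beyond it, the sums contain those with `k + 1` terms.
    · rcases le_total s (k + 1) with h | h
      · refine (min_le_left _ _).trans ?_
        obtain ⟨j, hj⟩ := Nat.exists_eq_add_of_le h
        have h1 := affDim_sumSet_add_le s j hprime
        rw [← hj, hfull, hDeq, hcard, hj] at h1
        linarith
      · refine (min_le_right _ _).trans ?_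
        rw [← hfull]
        exact affDim_mono (sumSet_subset_of_le (zero_mem_cone Y) h)
  rw [IsDefective, not_not, dim_secantVariety_add_one hs hY, hdim, hDeq, hkey]
  have h3 : Monotone (fun n : ℕ => (n : WithBot ℕ∞)) := Nat.mono_cast
  rw [h3.map_min]
  push_cast
  rfl

end SecantVarieties

/-! ### Segre products -/

section SegreProducts

variable {K : Type*} [Field K] {ι κ β : Type}

/-- If the points of the closure of `X` outside a coordinate hyperplane lie in `X`, then the same
is true for a variety whose cone consists of tensors with second factor in the cone of `X`. -/
theorem mem_of_mem_closure_of_tensor (E : κ × β ≃ ι) {X : Set (ℙ K (β → K))} (hX : X.Nonempty)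
    {Y : Set (ℙ K (ι → K))} (hcone : cone Y = tensorSet E (cone X)) {a₀ : κ} {b₀ : β}
    (hc : ∀ q ∈ closure X, q.rep b₀ ≠ 0 → q ∈ X) {q : ℙ K (ι → K)} (hq : q ∈ closure Y)
    (h : q.rep (E (a₀, b₀)) ≠ 0) : q ∈ Y := by
  rw [mem_closure_iff_eval] at hq
  have hY : ∀ p ∈ Y, ∃ u, ∃ v ∈ cone X, tensor E u v = p.rep := fun p hp => by
    have := rep_mem_cone.mpr hp
    rwa [hcone] at this
  rw [← rep_mem_cone, hcone]
  -- A rank-one matrix with nonzero pivot `(a₀, b₀)` is its pivot column over the pivot, times its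
  -- pivot row. The row lies in the cone of `X` because equations of `X` pull back to it; the
  -- rank-one property comes from the `2 × 2` minors.
  refine ⟨fun a => q.rep (E (a, b₀)) / q.rep (E (a₀, b₀)), fun b => q.rep (E (a₀, b)), ?_, ?_⟩
  · intro hv
    refine hc _ (mem_closure_iff_eval.mpr fun f d hf hfX => ?_) ?_
    · rw [eval_rep_mk hf]
      have := hq (rename (fun b => E (a₀, b)) f) d hf.rename_isHomogeneous fun p hp => by
        obtain ⟨u, v, hv, huv⟩ := hY p hp
        rw [eval_rename, ← huv]
        have hrow : (tensor E u v ∘ fun b => E (a₀, b)) = u a₀ • v := by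
          ext b
          simp [tensor]
        rw [hrow]
        exact eval_eq_zero_of_mem_cone hX hf hfX (smul_mem_cone hv (u a₀))
      rwa [eval_rename] at this
    · have := (eval_rep_mk (isHomogeneous_X K b₀) hv).not
      simp only [eval_X] at this
      exact this.mpr h
  · ext i
    obtain ⟨⟨a, b⟩, rfl⟩ := E.surjective i
    have := hq (MvPolynomial.X (E (a, b)) * MvPolynomial.X (E (a₀, b₀)) - MvPolynomial.X (E (a, b₀))
        * MvPolynomial.X (E (a₀, b))) 2
      (((isHomogeneous_X K _).mul (isHomogeneous_X K _)).sub
        ((isHomogeneous_X K _).mul (isHomogeneous_X K _))) fun p hp => by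
      obtain ⟨u, v, hv, huv⟩ := hY p hp
      rw [← huv]
      simp only [tensor, map_sub, map_mul, eval_X, Equiv.symm_apply_apply]
      ring
    simp only [map_sub, map_mul, eval_X] at this
    simp only [tensor, Equiv.symm_apply_apply]
    rw [div_mul_eq_mul_div, div_eq_iff h]
    linear_combination -this

/-- A variety with the cone of the Segre product of `ℙ^k` with a variety `X` spanning its ambient
space is never defective when `k` is the codimension of `X`. -/
theorem not_isDefective_of_cone_eq_tensorSet [IsAlgClosed K] [CharZero K] [Fintype ι] [Fintype β]
    {k : ℕ} (E : Fin (k + 1) × β ≃ ι) {X : Set (ℙ K (β → K))} (hX : IsIrreducible X)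
    (hspan : Submodule.span K (cone X) = ⊤) (hk : affDim (cone X) + k = Fintype.card β) {b₀ : β}
    {p : ℙ K (β → K)} (hp : p ∈ X) (hb : p.rep b₀ ≠ 0)
    (hc : ∀ q ∈ closure X, q.rep b₀ ≠ 0 → q ∈ X) {Y : Set (ℙ K (ι → K))}
    (hcone : cone Y = tensorSet E (cone X)) {s : ℕ} (hs : 1 ≤ s) : ¬ IsDefective s Y := by
  have : Infinite K := IsAlgClosed.instInfinite
  have hC := isPrime_cone_of_isIrreducible hX
  have hz : tensor E 1 p.rep (E (0, b₀)) ≠ 0 := by simpa [tensor] using hb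
  have hz0 : tensor E 1 p.rep ≠ 0 := fun h => hz (by rw [h]; rfl)
  have hzY : Projectivization.mk K _ hz0 ∈ Y := by
    rw [← mem_cone_iff, hcone]
    exact ⟨_, _, rep_mem_cone.mpr hp, rfl⟩
  have hY : IsIrreducible Y := isIrreducible_of_isPrime_cone ⟨_, hzY⟩ (by
    rw [hcone]
    exact isPrime_tensorSet E hC)
  refine not_isDefective_of_tensor E hC (fun v hv t => smul_mem_cone hv t) hspan hk hY
    (dim_add_one hY hzY (i := E (0, b₀)) ?_
      fun q hq h => mem_of_mem_closure_of_tensor E hX.nonempty hcone hc hq h) hcone hs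
  have := (eval_rep_mk (isHomogeneous_X K (E (0, b₀))) hz0).not
  simp only [eval_X] at this
  exact this.mpr hz

theorem cone_segreProduct (k : ℕ) (X : Set (ℙ K (β → K))) :
    cone (segreProduct k X) = tensorSet (Equiv.refl (Fin (k + 1) × β)) (cone X) := by
  ext z
  constructor
  · intro hz
    rcases eq_or_ne z 0 with rfl | h0
    · exact ⟨0, 0, zero_mem_cone X, by ext; simp [tensor]⟩
    · obtain ⟨⟨p, q⟩, ⟨-, hq⟩, h⟩ := hz h0
      obtain ⟨t, ht⟩ := (Projectivization.mk_eq_mk_iff' K _ _ _ _).mp h.symm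
      refine ⟨t • p.rep, q.rep, rep_mem_cone.mpr hq, ?_⟩
      rw [← ht]
      ext ij
      simp [tensor, mul_assoc]
  · rintro ⟨u, v, hv, rfl⟩ h0
    have hu0 : u ≠ 0 := by
      rintro rfl
      exact h0 (by ext; simp [tensor])
    have hv0 : v ≠ 0 := by
      rintro rfl
      exact h0 (by ext; simp [tensor])
    refine ⟨(Projectivization.mk K u hu0, Projectivization.mk K v hv0), ⟨Set.mem_univ _, hv hv0⟩,
        ?_⟩
    obtain ⟨a, ha⟩ := Projectivization.exists_smul_eq_mk_rep K u hu0
    obtain ⟨b, hb⟩ := Projectivization.exists_smul_eq_mk_rep K v hv0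
    refine (Projectivization.mk_eq_mk_iff' K _ _ _ _).mpr ⟨a * b, ?_⟩
    ext ij
    simp only [← ha, ← hb, tensor, Units.smul_def, Pi.smul_apply, smul_eq_mul, Equiv.refl_symm,
      Equiv.refl_apply]
    ring

theorem span_cone_eq_top {X : Set (ℙ K (ι → K))} (h : Projectivization.Subspace.span X = ⊤) :
    Submodule.span K (cone X) = ⊤ := by
  rw [eq_top_iff, ← OrderIso.map_top Projectivization.Subspace.submodule, ← h, submodule_span_eq]
  refine Submodule.span_mono ?_
  rintro _ ⟨p, hp, rfl⟩
  exact rep_mem_cone.mpr hp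

theorem not_isDefective_segreProduct [IsAlgClosed K] [CharZero K] [Fintype β] {n k : ℕ}
    {X : Set (ℙ K (β → K))} (hX : IsNondegenerateVariety X) (hn : dim X = n)
    (hk : n + 1 + k = Fintype.card β) {s : ℕ} (hs : 1 ≤ s) :
    ¬ IsDefective s (segreProduct k X) := by
  have hd := dim_add_one_of_isClosed hX.isIrreducible hX.isClosed
  rw [hn] at hd
  have hd' : n + 1 = affDim (cone X) := by exact_mod_cast hd
  obtain ⟨p, hp⟩ := hX.isIrreducible.nonempty
  obtain ⟨b, hb⟩ := Function.ne_iff.mp p.rep_nonzero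
  exact not_isDefective_of_cone_eq_tensorSet (Equiv.refl _) hX.isIrreducible
    (span_cone_eq_top hX.span_eq_top) (hd' ▸ hk) hp hb
    (fun q hq _ => hX.isClosed.closure_eq ▸ hq) (cone_segreProduct k X) hs

end SegreProducts

/-! ### Monomial vectors of Segre–Veronese maps -/

section SegreVeroneseVectors

variable {K : Type*} [Field K] {σ : Type} [Fintype σ] {n d : σ → ℕ}

/-- The affine Segre-Veronese map. -/
def segreVeroneseVec (n d : σ → ℕ) (v : ∀ i, Fin (n i + 1) → K) :
    (∀ i, Sym (Fin (n i + 1)) (d i)) → K :=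
  fun m => ∏ i, ((m i : Multiset (Fin (n i + 1))).map (v i)).prod

theorem segreVeroneseVec_smul (a : σ → K) (v : ∀ i, Fin (n i + 1) → K) :
    segreVeroneseVec n d (fun i => a i • v i) = (∏ i, a i ^ d i) • segreVeroneseVec n d v := by
  ext m
  simp only [segreVeroneseVec, Pi.smul_apply, smul_eq_mul, Multiset.prod_map_mul,
    Multiset.map_const', Multiset.prod_replicate, Finset.prod_mul_distrib, Sym.card_coe]

theorem segreVeroneseVec_eq_zero (hd : ∀ i, 1 ≤ d i) {v : ∀ i, Fin (n i + 1) → K} {i : σ}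
    (hi : v i = 0) : segreVeroneseVec n d v = 0 := by
  ext m
  refine Finset.prod_eq_zero (Finset.mem_univ i) ?_
  rw [hi]
  have : (m i : Multiset (Fin (n i + 1))) ≠ 0 := by
    rw [← Multiset.card_pos, Sym.card_coe]
    exact hd i
  obtain ⟨b, hb⟩ := Multiset.exists_mem_of_ne_zero this
  exact Multiset.prod_eq_zero (Multiset.mem_map.mpr ⟨b, hb, rfl⟩)

/-- The separate scalar `c` matters when there are no factors, or when scalars lack the required
roots. Positive degrees ensure that a zero vector in any factor gives the zero tensor. -/
theorem mem_cone_segreVeronese (hd : ∀ i, 1 ≤ d i) {z : (∀ i, Sym (Fin (n i + 1)) (d i)) → K} :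
    z ∈ cone (segreVeronese K n d) ↔
      ∃ (c : K) (v : ∀ i, Fin (n i + 1) → K), c • segreVeroneseVec n d v = z := by
  constructor
  · intro hz
    rcases eq_or_ne z 0 with rfl | h0
    · exact ⟨0, 0, zero_smul _ _⟩
    · obtain ⟨p, hp⟩ := hz h0
      obtain ⟨t, ht⟩ := (Projectivization.mk_eq_mk_iff' K _ _ _ _).mp hp.symm
      exact ⟨t, fun i => (p i).rep, ht⟩
  · rintro ⟨c, v, rfl⟩ h0
    have hv : ∀ i, v i ≠ 0 := fun i hi => h0 (by rw [segreVeroneseVec_eq_zero hd hi, smul_zero])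
    refine ⟨fun i => Projectivization.mk K (v i) (hv i), ?_⟩
    choose a ha using fun i => Projectivization.exists_smul_eq_mk_rep K (v i) (hv i)
    have hc : c ≠ 0 := left_ne_zero_of_smul h0
    refine (Projectivization.mk_eq_mk_iff' K _ _ _ _).mpr ⟨(∏ i, (a i : K) ^ d i) * c⁻¹, ?_⟩
    change _ = segreVeroneseVec n d fun i => (Projectivization.mk K (v i) (hv i)).rep
    simp only [← ha, Units.smul_def]
    rw [segreVeroneseVec_smul, smul_smul, mul_assoc, inv_mul_cancel₀ hc, mul_one]

/-- The parametrization of the cone of a Segre-Veronese variety. -/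
def segreVeroneseParam (n d : σ → ℕ) (x : Unit ⊕ (Σ i, Fin (n i + 1)) → K) :
    (∀ i, Sym (Fin (n i + 1)) (d i)) → K :=
  x (.inl ()) • segreVeroneseVec n d fun i b => x (.inr ⟨i, b⟩)

theorem isPolyFun_segreVeroneseParam (m : ∀ i, Sym (Fin (n i + 1)) (d i)) :
    IsPolyFun fun x : Unit ⊕ (Σ i, Fin (n i + 1)) → K => segreVeroneseParam n d x m :=
  (IsPolyFun.coord _).mul (.prod fun i => .multiset_prod fun b => .coord (Sum.inr (⟨i, b⟩ : Σ i, Fin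
      (n i + 1))))

theorem cone_segreVeronese (hd : ∀ i, 1 ≤ d i) :
    cone (segreVeronese K n d) = segreVeroneseParam n d '' Set.univ := by
  ext z
  rw [mem_cone_segreVeronese hd]
  constructor
  · rintro ⟨c, v, rfl⟩
    exact ⟨Sum.elim (fun _ => c) (fun ib => v ib.1 ib.2), Set.mem_univ _, rfl⟩
  · rintro ⟨x, -, rfl⟩
    exact ⟨_, _, rfl⟩

/-- The index of the monomial `x_{i, b} x_{i, 0} ^ (d - 1)`. -/
def linearIndex {n d : ℕ} (hd : 1 ≤ d) (b : Fin (n + 1)) : Sym (Fin (n + 1)) d :=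
  ⟨b ::ₘ Multiset.replicate (d - 1) 0, by
    rw [Multiset.card_cons, Multiset.card_replicate]
    omega⟩

/-- The index of the monomial `∏ i, x_{i, 0} ^ d i`. -/
def baseIndex (n d : σ → ℕ) (i : σ) : Sym (Fin (n i + 1)) (d i) := Sym.replicate (d i) 0

open Classical in
/-- The index of the monomial obtained from `∏ i, x_{i, 0} ^ d i` by replacing one factor `x_{i, 0}`
by `x_{i, b}`. -/
def nextIndex (hd : ∀ i, 1 ≤ d i) (ib : Σ i, Fin (n i + 1)) : ∀ i, Sym (Fin (n i + 1)) (d i) :=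
  Function.update (baseIndex n d) ib.1 (linearIndex (hd ib.1) ib.2)

theorem segreVeroneseVec_baseIndex (v : ∀ i, Fin (n i + 1) → K) :
    segreVeroneseVec n d v (baseIndex n d) = ∏ i, v i 0 ^ d i := by
  simp [segreVeroneseVec, baseIndex, Sym.coe_replicate]

theorem segreVeroneseVec_nextIndex (hd : ∀ i, 1 ≤ d i) (v : ∀ i, Fin (n i + 1) → K)
    (ib : Σ i, Fin (n i + 1)) :
    segreVeroneseVec n d v (nextIndex hd ib) * v ib.1 0 =
      v ib.1 ib.2 * segreVeroneseVec n d v (baseIndex n d) := by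
  classical
  obtain ⟨i, b⟩ := ib
  simp only [segreVeroneseVec]
  rw [← Finset.mul_prod_erase _ _ (Finset.mem_univ i),
    ← Finset.mul_prod_erase (a := i) _ (fun j => ((baseIndex n d j : Multiset _).map (v j)).prod)
      (Finset.mem_univ i)]
  have h1 : ∏ j ∈ Finset.univ.erase i,
      ((nextIndex hd ⟨i, b⟩ j : Multiset (Fin (n j + 1))).map (v j)).prod =
      ∏ j ∈ Finset.univ.erase i, ((baseIndex n d j : Multiset _).map (v j)).prod := by
    refine Finset.prod_congr rfl fun j hj => ?_
    rw [nextIndex, Function.update_of_ne (Finset.ne_of_mem_erase hj)]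
  have h2 : ((nextIndex hd ⟨i, b⟩ i : Multiset (Fin (n i + 1))).map (v i)).prod =
      v i b * v i 0 ^ (d i - 1) := by
    rw [nextIndex, Function.update_self]
    change ((b ::ₘ Multiset.replicate (d i - 1) 0).map (v i)).prod = _
    simp
  have h3 : ((baseIndex n d i : Multiset (Fin (n i + 1))).map (v i)).prod = v i 0 ^ (d i - 1) * v i
      0 := by
    rw [← pow_succ, Nat.sub_add_cancel (hd i)]
    simp [baseIndex, Sym.coe_replicate]
  rw [h1, h2, h3]
  ring

/-- The monomials of a Segre-Veronese vector are determined by those next to the base index. -/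
theorem segreVeroneseVec_relation (hd : ∀ i, 1 ≤ d i) (v : ∀ i, Fin (n i + 1) → K)
    (m : ∀ i, Sym (Fin (n i + 1)) (d i)) :
    segreVeroneseVec n d (fun i b => segreVeroneseVec n d v (nextIndex hd ⟨i, b⟩)) m *
        segreVeroneseVec n d v (baseIndex n d) =
      segreVeroneseVec n d v (baseIndex n d) ^ (∑ i, d i) * segreVeroneseVec n d v m := by
  have h1 : ∀ w u : ∀ i, Fin (n i + 1) → K, segreVeroneseVec n d (fun i b => w i b * u i b) m =
      segreVeroneseVec n d w m * segreVeroneseVec n d u m := fun w u => by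
    simp only [segreVeroneseVec, Multiset.prod_map_mul, Finset.prod_mul_distrib]
  have h2 : ∀ u : σ → K, segreVeroneseVec n d (fun i _ => u i) m = ∏ i, u i ^ d i := fun u => by
    simp [segreVeroneseVec]
  rw [segreVeroneseVec_baseIndex, ← h2 fun i => v i 0, ← h1]
  simp only [segreVeroneseVec_nextIndex hd v ⟨_, _⟩]
  rw [h1, h2 fun _ => segreVeroneseVec n d v (baseIndex n d), Finset.prod_pow_eq_pow_sum,
    segreVeroneseVec_baseIndex, h2, mul_comm]

end SegreVeroneseVectors

/-! ### Segre–Veronese varieties -/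

section SegreVeroneseVarieties

variable {K : Type*} [Field K] {σ : Type} [Fintype σ] {n d : σ → ℕ}

/-- Upper bound: on a dense set each factor can be normalized to have `0`-th coordinate `1`. Lower
bound: the base coordinate and its neighbours project the cone onto a set containing a dense open
subset of affine space of that dimension. -/
theorem affDim_cone_segreVeronese [Infinite K] (hd : ∀ i, 1 ≤ d i) :
    affDim (cone (segreVeronese K n d)) = ∑ i, n i + 1 := by
  have hcard : Nat.card (Unit ⊕ Σ i, Fin (n i)) = ∑ i, n i + 1 := by
    rw [Nat.card_eq_fintype_card, Fintype.card_sum, Fintype.card_sigma]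
    simp [add_comm]
  rw [← hcard, ← affDim_univ (K := K)]
  apply le_antisymm
  · have hg : IsPolyFun fun x : Unit ⊕ (Σ i, Fin (n i + 1)) → K => ∏ i, x (.inr ⟨i, 0⟩) :=
      .prod fun i => .coord (Sum.inr (⟨i, 0⟩ : Σ i, Fin (n i + 1)))
    rw [cone_segreVeronese hd, ← affDim_congr (vanishingIdeal_image_ne_zero
      isPolyFun_segreVeroneseParam isPrime_univ hg ⟨1, Set.mem_univ _, by simp⟩)]
    let V : (Unit ⊕ (Σ i, Fin (n i)) → K) → ∀ i, Fin (n i + 1) → K :=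
      fun y i => Fin.cons 1 fun b => y (.inr ⟨i, b⟩)
    have hV : ∀ i b, IsPolyFun fun y => V y i b := fun i b =>
      Fin.cases (.const 1) (fun b => .coord (Sum.inr (⟨i, b⟩ : Σ i, Fin (n i)))) b
    refine (affDim_mono ?_).trans (affDim_image_le
      (φ := fun y => y (.inl ()) • segreVeroneseVec n d (V y))
      (fun m => (IsPolyFun.coord _).mul (.prod fun i => .multiset_prod fun b => hV i b)) Set.univ)
    rintro _ ⟨x, ⟨-, hx⟩, rfl⟩
    rw [Finset.prod_ne_zero_iff] at hx
    refine ⟨Sum.elim (fun _ => x (.inl ()) * ∏ i, x (.inr ⟨i, 0⟩) ^ d i)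
      (fun ib => (x (.inr ⟨ib.1, 0⟩))⁻¹ * x (.inr ⟨ib.1, ib.2.succ⟩)), Set.mem_univ _, ?_⟩
    dsimp only [segreVeroneseParam, Sum.elim_inl]
    rw [mul_smul, ← segreVeroneseVec_smul]
    congr 2
    ext i b
    have := hx i (Finset.mem_univ i)
    refine Fin.cases ?_ (fun b => ?_) b <;> simp [V, this]
  · have hg : IsPolyFun fun x : Unit ⊕ (Σ i, Fin (n i)) → K => x (.inl ()) := .coord _
    rw [← Set.image_id (Set.univ : Set (Unit ⊕ (Σ i, Fin (n i)) → K)),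
      ← affDim_congr (vanishingIdeal_image_ne_zero (φ := id)
      (fun i => .coord i) isPrime_univ hg ⟨1, Set.mem_univ _, by simp⟩), Set.image_id]
    refine (affDim_mono ?_).trans (affDim_image_le (φ := fun z =>
      Sum.elim (fun _ => z (baseIndex n d)) fun ib => z (nextIndex hd ⟨ib.1, ib.2.succ⟩)) ?_ _)
    · rintro x ⟨-, hx⟩
      let v : ∀ i, Fin (n i + 1) → K := fun i => Fin.cons 1 fun b => x (.inr ⟨i, b⟩) / x (.inl ())
      refine ⟨_, (mem_cone_segreVeronese hd).mpr ⟨x (.inl ()), v, rfl⟩, ?_⟩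
      ext (u | ⟨i, b⟩)
      · simp [segreVeroneseVec_baseIndex, v]
      · have := segreVeroneseVec_nextIndex hd v ⟨i, b.succ⟩
        simp only [v, Fin.cons_zero, mul_one, Fin.cons_succ, segreVeroneseVec_baseIndex, one_pow,
          Finset.prod_const_one] at this
        simp only [v, Sum.elim_inr, Pi.smul_apply, smul_eq_mul, this]
        exact mul_div_cancel₀ _ hx
    · rintro (u | ib)
      · exact .coord (baseIndex n d)
      · exact .coord (nextIndex hd ⟨ib.1, ib.2.succ⟩)

theorem isHomogeneous_multiset_prod_X {ι α : Type*} (g : α → ι) (s : Multiset α) :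
    ((s.map fun a => (X (g a) : MvPolynomial ι K)).prod).IsHomogeneous s.card := by
  induction s using Multiset.induction_on with
  | empty => simpa using isHomogeneous_one ι K
  | cons a s ih =>
    rw [Multiset.map_cons, Multiset.prod_cons, Multiset.card_cons, add_comm]
    exact (isHomogeneous_X K _).mul ih

/-- The relations of `segreVeroneseVec_relation`, made homogeneous, persist on the closure. Where
the base coordinate is nonzero they express every coordinate through the neighbouring ones, which
serve as the vectors of the factors. -/
theorem mem_segreVeronese_of_mem_closure (hd : ∀ i, 1 ≤ d i)
    {q : ℙ K ((∀ i, Sym (Fin (n i + 1)) (d i)) → K)} (hq : q ∈ closure (segreVeronese K n d))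
    (h : q.rep (baseIndex n d) ≠ 0) : q ∈ segreVeronese K n d := by
  rw [mem_closure_iff_eval] at hq
  rw [← rep_mem_cone, mem_cone_segreVeronese hd]
  have key : ∀ m, segreVeroneseVec n d (fun i b => q.rep (nextIndex hd ⟨i, b⟩)) m *
      q.rep (baseIndex n d) = q.rep (baseIndex n d) ^ (∑ i, d i) * q.rep m := by
    intro m
    have hev : ∀ z : (∀ i, Sym (Fin (n i + 1)) (d i)) → K, eval z
        ((∏ i, ((m i : Multiset (Fin (n i + 1))).map
          fun b => (X (nextIndex hd ⟨i, b⟩) : MvPolynomial _ K)).prod) * X (baseIndex n d) -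
            X (baseIndex n d) ^ (∑ i, d i) * X m) =
        segreVeroneseVec n d (fun i b => z (nextIndex hd ⟨i, b⟩)) m * z (baseIndex n d) -
          z (baseIndex n d) ^ (∑ i, d i) * z m := by
      intro z
      simp [segreVeroneseVec, map_prod, map_multiset_prod]
    have hhom₁ := (IsHomogeneous.prod Finset.univ _ d fun i _ => by
      simpa using isHomogeneous_multiset_prod_X (K := K) (fun b => nextIndex hd ⟨i, b⟩)
        (m i : Multiset (Fin (n i + 1)))).mul (isHomogeneous_X K (baseIndex n d))
    have hhom₂ := ((isHomogeneous_X K (baseIndex n d)).pow (∑ i, d i)).mul (isHomogeneous_X K m)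
    rw [one_mul] at hhom₂
    have := hq _ _ (hhom₁.sub hhom₂) fun p hp => by
      obtain ⟨c, v, hcv⟩ := (mem_cone_segreVeronese hd).mp (rep_mem_cone.mpr hp)
      rw [hev, ← hcv, sub_eq_zero]
      have h1 := segreVeroneseVec_relation hd v m
      have h2 := congrFun (segreVeroneseVec_smul (n := n) (d := d) (fun _ => c)
        (fun i b => segreVeroneseVec n d v (nextIndex hd ⟨i, b⟩))) m
      rw [Finset.prod_pow_eq_pow_sum] at h2
      change segreVeroneseVec n d (fun i b => c * segreVeroneseVec n d v (nextIndex hd ⟨i, b⟩)) m =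
        c ^ _ * _ at h2
      simp only [Pi.smul_apply, smul_eq_mul]
      rw [h2, mul_pow]
      linear_combination (c ^ (∑ i, d i) * c) * h1
    rwa [hev, sub_eq_zero] at this
  refine ⟨q.rep (baseIndex n d) / q.rep (baseIndex n d) ^ (∑ i, d i),
    fun i b => q.rep (nextIndex hd ⟨i, b⟩), funext fun m => ?_⟩
  rw [Pi.smul_apply, smul_eq_mul, div_mul_eq_mul_div, div_eq_iff (pow_ne_zero _ h), mul_comm, key,
    mul_comm]

theorem isIrreducible_segreVeronese [Infinite K] (hd : ∀ i, 1 ≤ d i) :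
    IsIrreducible (segreVeronese K n d) := by
  refine isIrreducible_of_isPrime_cone (Set.range_nonempty_iff_nonempty.mpr
    ⟨fun i => Projectivization.mk K 1 one_ne_zero⟩) ?_
  rw [cone_segreVeronese hd]
  exact isPrime_image isPolyFun_segreVeroneseParam isPrime_univ

theorem exists_rep_baseIndex_ne_zero (hd : ∀ i, 1 ≤ d i) :
    ∃ p ∈ segreVeronese K n d, p.rep (baseIndex n d) ≠ 0 := by
  have h1 : segreVeroneseVec n d (fun i => (1 : Fin (n i + 1) → K)) (baseIndex n d) ≠ 0 := by
    simp [segreVeroneseVec_baseIndex]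
  have h0 : (1 : K) • segreVeroneseVec n d (fun i => (1 : Fin (n i + 1) → K)) ≠ 0 := by
    rw [one_smul]
    exact fun h => h1 (by rw [h]; rfl)
  refine ⟨_, (mem_cone_segreVeronese hd).mpr ⟨1, fun i => 1, rfl⟩ h0, ?_⟩
  have := (eval_rep_mk (isHomogeneous_X K (baseIndex n d)) h0).not
  simp only [eval_X, one_smul] at this ⊢
  exact this.mpr h1

/-- The exponent vector of a multihomogeneous monomial. -/
def exponent (m : ∀ i, Sym (Fin (n i + 1)) (d i)) : (Σ i, Fin (n i + 1)) →₀ ℕ :=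
  Finsupp.equivFunOnFinite.symm fun ib => (m ib.1 : Multiset (Fin (n ib.1 + 1))).count ib.2

theorem exponent_injective : Function.Injective (exponent (n := n) (d := d)) := by
  intro m m' h
  ext i b
  exact DFunLike.congr_fun h ⟨i, b⟩

theorem segreVeroneseVec_eq_eval_monomial (x : (Σ i, Fin (n i + 1)) → K)
    (m : ∀ i, Sym (Fin (n i + 1)) (d i)) :
    segreVeroneseVec n d (fun i b => x ⟨i, b⟩) m = eval x (monomial (exponent m) 1) := by
  classical
  rw [eval_monomial, one_mul, Finsupp.prod_fintype _ _ (by simp), Fintype.prod_sigma]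
  refine Finset.prod_congr rfl fun i _ => ?_
  rw [Finset.prod_multiset_map_count]
  refine Finset.prod_subset (Finset.subset_univ _) fun b _ hb => ?_
  rw [Multiset.mem_toFinset] at hb
  rw [Multiset.count_eq_zero_of_notMem hb, pow_zero]

/-- A linear form vanishing on the cone is a combination of distinct monomials that vanishes as a
function, so over an infinite field all its coefficients are zero. -/
theorem span_cone_segreVeronese [Infinite K] (hd : ∀ i, 1 ≤ d i) :
    Submodule.span K (cone (segreVeronese K n d)) = ⊤ := by
  classical
  by_contra hne
  obtain ⟨f, hf0, hf⟩ := Submodule.exists_le_ker_of_lt_top _ (lt_top_iff_ne_top.mpr hne)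
  refine hf0 (LinearMap.pi_ext' fun m => LinearMap.ext_ring ?_)
  have hp : (∑ m, monomial (exponent m) (f (Pi.single m 1)) :
      MvPolynomial (Σ i, Fin (n i + 1)) K) = 0 := by
    refine MvPolynomial.funext fun x => ?_
    rw [map_sum, map_zero]
    have hz : f (segreVeroneseVec n d fun i b => x ⟨i, b⟩) = 0 :=
      hf (Submodule.subset_span ((mem_cone_segreVeronese hd).mpr ⟨1, _, one_smul _ _⟩))
    rw [LinearMap.pi_apply_eq_sum_univ] at hz
    rw [← hz]
    refine Finset.sum_congr rfl fun m _ => ?_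
    rw [segreVeroneseVec_eq_eval_monomial, eval_monomial, eval_monomial, one_mul, mul_comm,
      smul_eq_mul]
    congr 2
    ext j
    simp [Pi.single_apply, eq_comm]
  have := congrArg (coeff (exponent m)) hp
  simpa [coeff_sum, coeff_monomial, exponent_injective.eq_iff] using this

theorem card_segreVeronese_index [DecidableEq σ] :
    Fintype.card (∀ i, Sym (Fin (n i + 1)) (d i)) = ∏ i, (n i + d i).choose (d i) := by
  rw [Fintype.card_pi]
  refine Finset.prod_congr rfl fun i _ => ?_
  rw [Sym.card_sym_eq_choose, Fintype.card_fin]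
  congr 1
  omega

/-- The coordinates of a Segre-Veronese variety whose first degree is `1`. -/
def consIndexEquiv {t : ℕ} (k : ℕ) (n d : Fin t → ℕ) :
    Fin (k + 1) × (∀ i, Sym (Fin (n i + 1)) (d i)) ≃
      (∀ i, Sym (Fin ((Fin.cons k n : Fin (t + 1) → ℕ) i + 1))
        ((Fin.cons 1 d : Fin (t + 1) → ℕ) i)) :=
  (Equiv.prodCongr Sym.oneEquiv (Equiv.refl _)).trans (Fin.consEquiv
    fun i => Sym (Fin ((Fin.cons k n : Fin (t + 1) → ℕ) i + 1))
      ((Fin.cons 1 d : Fin (t + 1) → ℕ) i))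

theorem segreVeroneseVec_consIndexEquiv {t : ℕ} {k : ℕ} {n d : Fin t → ℕ}
    (v : ∀ i, Fin ((Fin.cons k n : Fin (t + 1) → ℕ) i + 1) → K)
    (a : Fin (k + 1)) (m : ∀ i, Sym (Fin (n i + 1)) (d i)) :
    segreVeroneseVec (Fin.cons k n : Fin (t + 1) → ℕ) (Fin.cons 1 d : Fin (t + 1) → ℕ) v
      (consIndexEquiv k n d (a, m)) = v 0 a * segreVeroneseVec n d (fun i => v i.succ) m := by
  rw [segreVeroneseVec, Fin.prod_univ_succ]
  congr 1
  exact (congrArg Multiset.prod (Multiset.map_singleton (v 0) a)).trans (Multiset.prod_singleton _)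

/-- Degree `1` makes the map linear in the first factor, which therefore splits off as a tensor
factor. -/
theorem cone_segreVeronese_cons {t : ℕ} (k : ℕ) {n d : Fin t → ℕ} (hd : ∀ i, 1 ≤ d i) :
    cone (segreVeronese K (Fin.cons k n : Fin (t + 1) → ℕ) (Fin.cons 1 d : Fin (t + 1) → ℕ)) =
      tensorSet (consIndexEquiv k n d) (cone (segreVeronese K n d)) := by
  have hd' : ∀ i, 1 ≤ (Fin.cons 1 d : Fin (t + 1) → ℕ) i :=
    fun i => Fin.cases le_rfl hd i
  ext z
  rw [mem_cone_segreVeronese hd']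
  constructor
  · rintro ⟨c, v, rfl⟩
    refine ⟨v 0, _, (mem_cone_segreVeronese hd).mpr ⟨c, fun i => v i.succ, rfl⟩, funext fun j => ?_⟩
    obtain ⟨⟨a, m⟩, rfl⟩ := (consIndexEquiv k n d).surjective j
    rw [Pi.smul_apply, segreVeroneseVec_consIndexEquiv]
    simp only [tensor, Equiv.symm_apply_apply, Pi.smul_apply, smul_eq_mul]
    ring
  · rintro ⟨u, w, hw, rfl⟩
    obtain ⟨c, v, rfl⟩ := (mem_cone_segreVeronese hd).mp hw
    refine ⟨c, Fin.cons (α := fun i => Fin ((Fin.cons k n : Fin (t + 1) → ℕ) i + 1) → K) u v,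
      funext fun j => ?_⟩
    obtain ⟨⟨a, m⟩, rfl⟩ := (consIndexEquiv k n d).surjective j
    rw [Pi.smul_apply, segreVeroneseVec_consIndexEquiv]
    simp only [tensor, Equiv.symm_apply_apply, Pi.smul_apply, smul_eq_mul]
    exact mul_left_comm c (u a) (segreVeroneseVec n d v m)

theorem not_isDefective_segreVeronese_cons [IsAlgClosed K] [CharZero K] {t k : ℕ} {n d : Fin t → ℕ}
    (hd : ∀ i, 1 ≤ d i) (hk : ∑ i, n i + 1 + k = ∏ i, (n i + d i).choose (d i)) {s : ℕ}
    (hs : 1 ≤ s) :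
    ¬ IsDefective s (segreVeronese K (Fin.cons k n : Fin (t + 1) → ℕ)
      (Fin.cons 1 d : Fin (t + 1) → ℕ)) := by
  have : Infinite K := IsAlgClosed.instInfinite
  obtain ⟨p, hp, hb⟩ := exists_rep_baseIndex_ne_zero (K := K) (n := n) hd
  exact not_isDefective_of_cone_eq_tensorSet (consIndexEquiv k n d)
    (isIrreducible_segreVeronese hd) (span_cone_segreVeronese hd)
    (by rw [affDim_cone_segreVeronese hd, card_segreVeronese_index, hk]) hp hb
    (fun q hq h => mem_segreVeronese_of_mem_closure hd hq h) (cone_segreVeronese_cons k hd) hs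

end SegreVeroneseVarieties

end SecantVar

end

theorem corollary5p6 {K : Type*} [Field K] [IsAlgClosed K] [CharZero K] :
    (∀ (r n k : ℕ) (X : Set (ℙ K (Fin (r + 1) → K))),
      SecantVar.IsNondegenerateVariety X → SecantVar.dim X = n → (k : ℤ) = (r : ℤ) - (n : ℤ) →
      ∀ s : ℕ, 1 ≤ s → ¬ SecantVar.IsDefective s (SecantVar.segreProduct k X)) ∧
    (∀ n s : ℕ, 1 ≤ s →
      ¬ SecantVar.IsDefective s
        (SecantVar.segreVeronese K ![(n + 1).choose 2, n] ![1, 2])) ∧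
    (∀ (t : ℕ) (n d : Fin t → ℕ) (k : ℕ), (∀ i, 1 ≤ d i) →
      (k : ℤ) = (∏ i, ((n i + d i).choose (d i) : ℤ)) - (∑ i, (n i : ℤ)) - 1 →
      ∀ s : ℕ, 1 ≤ s →
        ¬ SecantVar.IsDefective s
          (SecantVar.segreVeronese K (Fin.cons k n : Fin (t + 1) → ℕ)
            (Fin.cons 1 d : Fin (t + 1) → ℕ))) := by
  refine ⟨fun r n k X hX hn hk s hs => ?_, fun n s hs => ?_, fun t n d k hd hk s hs => ?_⟩
  · refine SecantVar.not_isDefective_segreProduct hX hn ?_ hs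
    rw [Fintype.card_fin]
    omega
  -- The case of one factor of degree `2`: Pascal's rule gives `(n + 2).choose 2 - n - 1 = (n +
  -- 1).choose 2`.
  · refine SecantVar.not_isDefective_segreVeronese_cons (n := ![n]) (d := ![2]) (by simp) ?_ hs
    simp only [Finset.univ_unique, Finset.sum_singleton, Finset.prod_singleton,
      Matrix.cons_val_fin_one, Fin.default_eq_zero]
    have h1 : (n + 2).choose 2 = (n + 1) + (n + 1).choose 2 := by
      rw [Nat.choose_succ_succ' (n + 1) 1, Nat.choose_one_right]
    omega
  · refine SecantVar.not_isDefective_segreVeronese_cons hd ?_ hs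
    zify
    linarith
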